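/- **Setting.** Consider an infinite-horizon dynamic discrete choice model with a finite observed state space $X=\{1,\dots,K\}$, choices $D=\{0,1,\dots,J\}$, a discount factor $\beta\in[0,1)$, transition probabilities $G_x^d$ on $X$ (the law of $x_{t+1}$ given $x_t=x$, $d_t=d$), an initial distribution $\nu$ on $X$, and per-period utility $u(x,d;\theta)+\epsilon_d$ with $\theta\in\mathbb R^{p}$. The normalization $\epsilon_0=0$ is imposed, and $(\epsilon_1,\dots,\epsilon_J)$ is i.i.d. over time with distribution $F$ on $\mathbb R^J$. Let $Q=Q(\cdot;\theta,F)$ solve the Bellman equation $$Q(x)=\int\max_{j}\big[u(x,j;\theta)+\beta G_x^jQ+\epsilon_j\big]\,dF(\epsilon),\qquad G_x^jQ=\sum_{y\in X}G_x^j(y)\,Q(y),$$ let $p(d|x;\theta,F)=F\{\epsilon:\ u(x,d;\theta)+\beta G_x^dQ+\epsilon_d\ge u(x,j;\theta)+\beta G_x^jQ+\epsilon_j\ \ \forall j\}$ be the conditional choice probabilities, and let $P(\theta,F)=(p(d|x;\theta,F))_{x\in X,\,d\in D}$. **Data.** The histories $D_i=(x_{it},d_{it})_{t=1,\dots,T}$,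 $i=1,2,\dots$ ($T\ge1$ fixed), are i.i.d. over $i$. In each history $x_{i1}\sim\nu$, $d_{it}\sim p(\cdot|x_{it};\theta_0,F_0)$ given the past and $x_{it}$, and $x_{i,t+1}\sim G_{x_{it}}^{d_{it}}$. Write $D^n=(D_1,\dots,D_n)$. **Prior.** Let $\phi(\cdot;\mu,\sigma)$, $\mu\in\mathbb R^J$, $\sigma>0$, be the product Gumbel density $\prod_{j=1}^J\frac1\sigma\phi\big(\frac{z_j-\mu_j}\sigma\big)$, where $\phi(s)=e^{-s-\gamma-e^{-s-\gamma}}$ and $\gamma$ is the Euler–Mascheroni constant. The prior $\Pi$ is a probability distribution for $\theta$, $m\in\{1,2,\dots\}$ and $(\mu_k,\sigma_k,w_k)_{k\le m}$, with $\sigma_k>0$, $w_k\ge0$, $\sum_kw_k=1$. The shock distribution $F$ has density $\sum_{k=1}^mw_k\,\phi(\cdot;\mu_k,\sigma_k)$. The posterior is $$\Pi(A|D^n)=\frac{\int_A L_n\,d\Pi}{\int L_n\,d\Pi},\qquad L_n(\theta,F)=\prod_{i\le n}\prod_{t\le T}p(d_{it}|x_{it};\theta,F).$$ **Theorem 1.**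 Suppose that 1. $G_x^d$ and $\nu$ are known and fixed; 2. for every $x\in X$ there is $t\le T$ with $\Pr(x_{it}=x)>0$; 3. $u(x,d;\theta)$ is continuous in $\theta$; 4. $F_0$ has a density $f$ on $\mathbb R^J$ with $\int\|z\|_2f(z)\,dz<\infty$, and for some $\tau>0$ and some function $L_f$ one has $|f(z+h)-f(z)|\le\|h\|_2L_f(z)e^{\tau\|h\|_2}$ for all $z,h$, and $\int(1+|z_i|)L_f(z)\,dz<\infty$ for $i=1,\dots,J$; 5. for every $\delta>0$, every $m\ge1$ and all $\mu_k\in\mathbb R^J$, $\sigma_k>0$, $w_k\ge0$ $(k\le m)$ with $\sum_kw_k=1$, the prior gives positive probability to the event that $\theta$ lies within $\delta$ of $\theta_0$, the number of components is $m$, and the mixture parameters lie within $\delta$ of $(\mu_k,\sigma_k,w_k)_{k\le m}$. (When $\theta$ and the mixture parameters are a priori independent, this says that $\Pi(B_\delta(\theta_0))>0$, $\Pi(m)>0$ and $\Pi(B_\delta((\mu_k,\sigma_k,w_k)_{k\le m})\,|\,m)>0$.) Then the posterior is well defined ($0<\int L_n\,d\Pi<\infty$ for all $n$, almost surely), and for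 every $\delta>0$ $$\Pi\big((\theta,F):\ \|P(\theta_0,F_0)-P(\theta,F)\|>\delta\ \big|\ D^n\big)\longrightarrow0\qquad\text{almost surely as }n\to\infty .$$ -/

import Mathlib

open MeasureTheory

/-- The primitives of a stationary infinite-horizon dynamic discrete choice model with observed
states `Fin K`, choices `0, …, J`, and utilities indexed by a parameter in `ℝ^p`. -/
structure ChoiceModel (J K p : ℕ) where
  /-- time discount factor -/
  beta : ℝ
  beta_nonneg : 0 ≤ beta
  beta_lt_one : beta < 1
  /-- `G d x y` is the probability that the next state is `y` after choice `d` in state `x` -/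
  G : Fin (J + 1) → Fin K → Fin K → ℝ
  G_nonneg : ∀ d x y, 0 ≤ G d x y
  G_sum : ∀ d x, ∑ y, G d x y = 1
  /-- distribution of the initial observed state -/
  init : Fin K → ℝ
  init_nonneg : ∀ x, 0 ≤ init x
  init_sum : ∑ x, init x = 1
  /-- per-period utility `u x d θ` -/
  u : Fin K → Fin (J + 1) → EuclideanSpace ℝ (Fin p) → ℝ

/-- The vector of all `J + 1` shocks under the normalization that the shock of choice `0` is `0`. -/
def shock {J : ℕ} (e : Fin J → ℝ) : Fin (J + 1) → ℝ := Fin.cons 0 e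

namespace ChoiceModel

variable {J K p : ℕ} (M : ChoiceModel J K p)

/-- `u(x,d;θ) + β ∑ y, G d x y * Q y`. -/
def value (θ : EuclideanSpace ℝ (Fin p)) (Q : Fin K → ℝ) (x : Fin K) (d : Fin (J + 1)) : ℝ :=
  M.u x d θ + M.beta * ∑ y, M.G d x y * Q y

/-- The Bellman operator: expected maximum over choices under the shock distribution `F`. -/
noncomputable def bellman (θ : EuclideanSpace ℝ (Fin p)) (F : Measure (Fin J → ℝ))
    (Q : Fin K → ℝ) (x : Fin K) : ℝ :=
  ∫ e, Finset.univ.sup' Finset.univ_nonempty (fun d => M.value θ Q x d + shock e d) ∂F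

/-- The Emax function: the solution of the Bellman equation
(it exists and is unique for integrable shocks, see `existsUnique_bellman`). -/
noncomputable def emax (θ : EuclideanSpace ℝ (Fin p)) (F : Measure (Fin J → ℝ)) : Fin K → ℝ :=
  Classical.epsilon fun Q => M.bellman θ F Q = Q

/-- The conditional choice probability `p(d|x;θ,F)`. -/
noncomputable def ccp (θ : EuclideanSpace ℝ (Fin p)) (F : Measure (Fin J → ℝ))
    (x : Fin K) (d : Fin (J + 1)) : ℝ :=
  F.real {e | ∀ j, M.value θ (M.emax θ F) x j + shock e j ≤
    M.value θ (M.emax θ F) x d + shock e d}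

/-- The collection `P(θ,F)` of all conditional choice probabilities, as a Euclidean vector. -/
noncomputable def ccpVec (θ : EuclideanSpace ℝ (Fin p)) (F : Measure (Fin J → ℝ)) :
    EuclideanSpace ℝ (Fin K × Fin (J + 1)) :=
  WithLp.toLp 2 fun xd => M.ccp θ F xd.1 xd.2

theorem integrable_max {F : Measure (Fin J → ℝ)} [IsProbabilityMeasure F]
    (hF : ∀ j, Integrable (fun e : Fin J → ℝ => e j) F) (a : Fin (J + 1) → ℝ) :
    Integrable (fun e => Finset.univ.sup' Finset.univ_nonempty (fun d => a d + shock e d)) F := by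
  have h1 : ∀ d, Integrable (fun e : Fin J → ℝ => a d + shock e d) F := by
    intro d
    refine (integrable_const _).add ?_
    refine Fin.cases ?_ (fun j => ?_) d
    · simp [shock]
    · simpa [shock] using hF j
  have h2 := Finset.sup'_induction (p := fun g : (Fin J → ℝ) → ℝ => Integrable g F)
    Finset.univ_nonempty (fun d e => a d + shock e d) (fun f hf g hg => hf.sup hg)
    (fun d _ => h1 d)
  convert h2 using 1
  ext e
  exact (Finset.sup'_apply Finset.univ_nonempty (fun d (e : Fin J → ℝ) => a d + shock e d) e).symm

/-- With integrable shocks the Bellman equation has exactly one solution. -/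
theorem existsUnique_bellman (θ : EuclideanSpace ℝ (Fin p)) (F : Measure (Fin J → ℝ))
    [IsProbabilityMeasure F] (hF : ∀ j, Integrable (fun e : Fin J → ℝ => e j) F) :
    ∃! Q, M.bellman θ F Q = Q := by
  have key : ∀ Q R x, M.bellman θ F Q x ≤ M.bellman θ F R x + M.beta * dist Q R := by
    intro Q R x
    have hv : ∀ d, M.value θ Q x d ≤ M.value θ R x d + M.beta * dist Q R := by
      intro d
      have hs : ∑ y, M.G d x y * Q y ≤ ∑ y, M.G d x y * R y + dist Q R := by
        calc ∑ y, M.G d x y * Q y ≤ ∑ y, (M.G d x y * R y + M.G d x y * dist Q R) := by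
              refine Finset.sum_le_sum fun y _ => ?_
              have := (le_abs_self _).trans ((Real.dist_eq (Q y) (R y)).symm.le.trans
                (dist_le_pi_dist Q R y))
              nlinarith [M.G_nonneg d x y]
          _ = _ := by rw [Finset.sum_add_distrib, ← Finset.sum_mul, M.G_sum, one_mul]
      have := mul_le_mul_of_nonneg_left hs M.beta_nonneg
      unfold value
      linarith
    have hi := integrable_max hF (M.value θ R x)
    have : M.bellman θ F R x + M.beta * dist Q R = ∫ e, (Finset.univ.sup' Finset.univ_nonempty
        (fun d => M.value θ R x d + shock e d) + M.beta * dist Q R) ∂F := by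
      rw [integral_add hi (integrable_const _)]
      simp [bellman]
    rw [this]
    refine integral_mono (integrable_max hF _) (hi.add (integrable_const _)) fun e => ?_
    refine Finset.sup'_le _ _ fun d hd => ?_
    have := Finset.le_sup' (fun d => M.value θ R x d + shock e d) hd
    have := hv d
    simp only at *
    linarith
  have hc : ContractingWith ⟨M.beta, M.beta_nonneg⟩ (M.bellman θ F) := by
    refine ⟨by exact_mod_cast M.beta_lt_one, LipschitzWith.of_dist_le_mul fun Q R => ?_⟩
    refine (dist_pi_le_iff (mul_nonneg M.beta_nonneg dist_nonneg)).2 fun x => ?_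
    rw [Real.dist_eq, abs_le]
    have h1 := key Q R x
    have h2 := key R Q x
    rw [dist_comm R Q] at h2
    change -(M.beta * dist Q R) ≤ _ ∧ _ ≤ M.beta * dist Q R
    constructor <;> linarith
  exact ⟨hc.fixedPoint, hc.fixedPoint_isFixedPt, fun Q hQ => hc.fixedPoint_unique hQ⟩

end ChoiceModel

/-- The univariate mean-zero Gumbel density. -/
noncomputable def gumbel (z : ℝ) : ℝ :=
  Real.exp (-z - Real.eulerMascheroniConstant -
    Real.exp (-z - Real.eulerMascheroniConstant))

/-- The `J`-variate Gumbel density with location `μ` and scale `σ`. -/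
noncomputable def gumbelDensity {J : ℕ} (μ : Fin J → ℝ) (σ : ℝ) (z : Fin J → ℝ) : ℝ :=
  ∏ j, (1 / σ) * gumbel ((z j - μ j) / σ)

/-- Parameters `(μ_k, σ_k, w_k)`, `k < m`, of a mixture of `m` Gumbel densities on `ℝ^J`: positive
scales, weights in the unit simplex. (There are none for `m = 0`.) -/
abbrev MixtureParam (J m : ℕ) : Type :=
  {q : (Fin m → Fin J → ℝ) × (Fin m → ℝ) × (Fin m → ℝ) //
    (∀ k, 0 < q.2.1 k) ∧ (∀ k, 0 ≤ q.2.2 k) ∧ ∑ k, q.2.2 k = 1}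

/-- Parameters of Gumbel mixtures with a variable number of components. -/
abbrev Mixture (J : ℕ) : Type := Σ m : ℕ, MixtureParam J m

/-- The shock distribution with density `∑ k, w_k φ(·; μ_k, σ_k)`. -/
noncomputable def mixtureLaw {J : ℕ} (q : Mixture J) : Measure (Fin J → ℝ) :=
  volume.withDensity fun z =>
    ENNReal.ofReal (∑ k, q.2.1.2.2 k * gumbelDensity (q.2.1.1 k) (q.2.1.2.1 k) z)

/-- `f` is a probability density on `ℝ^I` with a finite first moment and the smoothness property
`|f(z+h) - f(z)| ≤ ‖h‖₂ L(z) exp(τ‖h‖₂)` for an envelope `L` with `∫ (1+|z_i|) L(z) dz < ∞`. -/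
structure IsSmoothDensity {I : ℕ} (f : (Fin I → ℝ) → ℝ) : Prop where
  measurable : Measurable f
  nonneg : ∀ z, 0 ≤ f z
  integral_eq_one : ∫ z, f z = 1
  moment : Integrable fun z : Fin I → ℝ => ‖WithLp.toLp 2 z‖ * f z
  smooth : ∃ τ : ℝ, 0 < τ ∧ ∃ L : (Fin I → ℝ) → ℝ,
    (∀ z h : Fin I → ℝ, |f (z + h) - f z| ≤
      ‖WithLp.toLp 2 h‖ * L z * Real.exp (τ * ‖WithLp.toLp 2 h‖)) ∧
    ∀ i, Integrable fun z : Fin I → ℝ => (1 + |z i|) * L z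

/-- Observations `(x_t, d_t)` on one decision maker over the `T + 1` periods `t = 0, …, T`. -/
abbrev History (J K T : ℕ) : Type := Fin (T + 1) → Fin K × Fin (J + 1)

namespace ChoiceModel

variable {J K p : ℕ} (M : ChoiceModel J K p)

/-- The probability of a history: the initial state is drawn from `M.init`, choices from the
conditional choice probabilities, and states move according to `M.G`. -/
noncomputable def historyProb {T : ℕ} (θ : EuclideanSpace ℝ (Fin p)) (F : Measure (Fin J → ℝ))
    (h : History J K T) : ℝ :=
  M.init (h 0).1 * (∏ t, M.ccp θ F (h t).1 (h t).2) *
    ∏ t : Fin T, M.G (h t.castSucc).2 (h t.castSucc).1 (h t.succ).1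

/-- The (partial) likelihood `∏ i < n, ∏ t, p(d_it | x_it; θ, F)` of the first `n` histories;
the omitted factors of the full likelihood do not depend on `(θ, F)`. -/
noncomputable def likelihood {T : ℕ} (θ : EuclideanSpace ℝ (Fin p)) (F : Measure (Fin J → ℝ))
    (n : ℕ) (D : ℕ → History J K T) : ℝ :=
  ∏ i ∈ Finset.range n, ∏ t, M.ccp θ F (D i t).1 (D i t).2

/-- The marginal likelihood of the first `n` histories under `prior`. -/
noncomputable def evidence {T : ℕ} (prior : Measure (EuclideanSpace ℝ (Fin p) × Mixture J))
    (n : ℕ) (D : ℕ → History J K T) : ENNReal :=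
  ∫⁻ q, ENNReal.ofReal (M.likelihood q.1 (mixtureLaw q.2) n D) ∂prior

/-- The posterior probability of a set `A` of parameters given the first `n` histories. -/
noncomputable def posterior {T : ℕ} (prior : Measure (EuclideanSpace ℝ (Fin p) × Mixture J))
    (n : ℕ) (D : ℕ → History J K T) (A : Set (EuclideanSpace ℝ (Fin p) × Mixture J)) : ENNReal :=
  (∫⁻ q in A, ENNReal.ofReal (M.likelihood q.1 (mixtureLaw q.2) n D) ∂prior) / M.evidence prior n D

end ChoiceModel

/-! The likelihood depends on `(θ, F)` only through the finite vector of conditional choice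
probabilities. Consistency is therefore Schwartz's argument in finite dimension: likelihood ratios
far from the truth decay exponentially, while the prior charges parameters whose likelihood ratio
decays more slowly.

Upper bound. Since `log r ≤ 2 (√r - 1)`, the log-likelihood ratio is bounded by a sum over cells
(state, choice) of observed counts times a function that is bounded uniformly over the competing
probabilities. The strong law for the cell frequencies then makes the bound uniform: outside the
`δ`-ball the ratio is eventually at most `exp(-3na)` (`exists_choiceLikelihood_le`).

Lower bound. If no choice probability falls short of the true one by more than a small `ε`, the
ratio is at least `exp(-na)` (`exists_exp_mul_le_choiceLikelihood`). Once the prior gives positive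
mass to a set `U` of such parameters, the posterior of the far set is at most `exp(-2na) / prior U`.

Prior mass. Shock laws are compared by integrals of `1`-Lipschitz functions. The Bellman operator is
a contraction whose integrand is `1`-Lipschitz in the shocks, so its fixed point is stable in this
distance. Choice regions are closed, so choice probabilities are upper semicontinuous
(`exists_ccp_le_add`). As `F₀` has a density, ties are null and the probabilities sum to one, which
turns upper bounds on the other choices into a lower bound on each. Finally, Gumbel mixtures are
dense in this distance (`exists_mixtureLaw_lipschitzClose`): approximate `F₀` by a law with finitely
many atoms and replace each atom by a narrow Gumbel law. They are also continuous in their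
parameters (`exists_lipschitzClose_of_mem_ball`). -/

/-! ### Kantorovich closeness of shock laws; maximal utility and regret -/

/-- `F` and `F'` assign integrals within `η` of each other to every `1`-Lipschitz function. -/
def LipschitzClose {J : ℕ} (η : ℝ) (F F' : Measure (Fin J → ℝ)) : Prop :=
  ∀ g : (Fin J → ℝ) → ℝ, LipschitzWith 1 g → |∫ e, g e ∂F - ∫ e, g e ∂F'| ≤ η

theorem LipschitzClose.trans {J : ℕ} {η η' : ℝ} {F F' F'' : Measure (Fin J → ℝ)}
    (h : LipschitzClose η F F') (h' : LipschitzClose η' F' F'') :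
    LipschitzClose (η + η') F F'' := fun g hg =>
  (abs_sub_le _ _ _).trans (add_le_add (h g hg) (h' g hg))

theorem LipschitzClose.mono {J : ℕ} {η η' : ℝ} {F F' : Measure (Fin J → ℝ)}
    (h : LipschitzClose η F F') (hη : η ≤ η') : LipschitzClose η' F F' :=
  fun g hg => (h g hg).trans hη

theorem abs_shock_sub_le {J : ℕ} (e e' : Fin J → ℝ) (d : Fin (J + 1)) :
    |shock e d - shock e' d| ≤ dist e e' := by
  refine Fin.cases ?_ (fun j => ?_) d
  · simp [shock]
  · simpa [shock, Real.dist_eq] using dist_le_pi_dist e e' j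

theorem continuous_shock {J : ℕ} (d : Fin (J + 1)) :
    Continuous fun e : Fin J → ℝ => shock e d := by
  refine Fin.cases ?_ (fun j => ?_) d
  · simpa [shock] using continuous_const
  · simpa [shock] using continuous_apply j

/-- The largest of the numbers `a d + shock e d`. -/
noncomputable def maxUtility {J : ℕ} (a : Fin (J + 1) → ℝ) (e : Fin J → ℝ) : ℝ :=
  Finset.univ.sup' Finset.univ_nonempty fun d => a d + shock e d

theorem le_maxUtility {J : ℕ} (a : Fin (J + 1) → ℝ) (e : Fin J → ℝ) (d : Fin (J + 1)) :
    a d + shock e d ≤ maxUtility a e :=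
  Finset.le_sup' (fun d => a d + shock e d) (Finset.mem_univ d)

theorem maxUtility_le_iff {J : ℕ} (a : Fin (J + 1) → ℝ) (e : Fin J → ℝ) (c : ℝ) :
    maxUtility a e ≤ c ↔ ∀ d, a d + shock e d ≤ c := by
  simp [maxUtility, Finset.sup'_le_iff]

theorem maxUtility_le_add {J : ℕ} {a b : Fin (J + 1) → ℝ} {κ : ℝ} (h : ∀ d, |a d - b d| ≤ κ)
    (e e' : Fin J → ℝ) : maxUtility a e ≤ maxUtility b e' + (κ + dist e e') := by
  refine (maxUtility_le_iff _ _ _).2 fun d => ?_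
  have h1 := le_maxUtility b e' d
  have h2 := (abs_le.1 (h d)).2
  have h3 := (abs_le.1 (abs_shock_sub_le e e' d)).2
  linarith

theorem abs_maxUtility_sub_le {J : ℕ} {a b : Fin (J + 1) → ℝ} {κ : ℝ} (h : ∀ d, |a d - b d| ≤ κ)
    (e e' : Fin J → ℝ) : |maxUtility a e - maxUtility b e'| ≤ κ + dist e e' := by
  have h1 := maxUtility_le_add h e e'
  have h2 := maxUtility_le_add (a := b) (b := a) (fun d => by rw [abs_sub_comm]; exact h d) e' e
  rw [dist_comm] at h2
  exact abs_le.2 ⟨by linarith, by linarith⟩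

theorem lipschitzWith_maxUtility {J : ℕ} (a : Fin (J + 1) → ℝ) :
    LipschitzWith 1 (maxUtility a) := by
  refine LipschitzWith.of_dist_le_mul fun e e' => ?_
  simpa [Real.dist_eq] using abs_maxUtility_sub_le (a := a) (b := a) (κ := 0) (by simp) e e'

theorem integrable_maxUtility {J : ℕ} {F : Measure (Fin J → ℝ)} [IsProbabilityMeasure F]
    (hF : ∀ j, Integrable (fun e : Fin J → ℝ => e j) F) (a : Fin (J + 1) → ℝ) :
    Integrable (maxUtility a) F :=
  ChoiceModel.integrable_max hF a

/-- How much the utility of choice `d` falls short of the largest utility. -/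
noncomputable def regret {J : ℕ} (a : Fin (J + 1) → ℝ) (d : Fin (J + 1)) (e : Fin J → ℝ) : ℝ :=
  maxUtility a e - (a d + shock e d)

/-- A choice region becomes a sublevel set of a Lipschitz function of the shocks, which can be
relaxed to small positive levels. -/
theorem setOf_best_eq {J : ℕ} (a : Fin (J + 1) → ℝ) (d : Fin (J + 1)) :
    {e : Fin J → ℝ | ∀ j, a j + shock e j ≤ a d + shock e d} = {e | regret a d e ≤ 0} := by
  ext e
  simp [regret, ← maxUtility_le_iff]

theorem abs_regret_sub_le {J : ℕ} {a b : Fin (J + 1) → ℝ} {κ : ℝ} (h : ∀ d, |a d - b d| ≤ κ)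
    (d : Fin (J + 1)) (e e' : Fin J → ℝ) :
    |regret a d e - regret b d e'| ≤ 2 * κ + 2 * dist e e' := by
  have h1 := abs_le.1 (abs_maxUtility_sub_le h e e')
  have h2 := abs_le.1 (h d)
  have h3 := abs_le.1 (abs_shock_sub_le e e' d)
  unfold regret
  exact abs_le.2 ⟨by linarith, by linarith⟩

theorem continuous_regret {J : ℕ} (a : Fin (J + 1) → ℝ) (d : Fin (J + 1)) :
    Continuous (regret a d) :=
  (lipschitzWith_maxUtility a).continuous.sub (continuous_const.add (continuous_shock d))

/-- A perturbed choice probability is at most a relaxed unperturbed one, up to the Lipschitz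
distance between the shock distributions. -/
theorem measureReal_best_le {J : ℕ} {F F' : Measure (Fin J → ℝ)} [IsProbabilityMeasure F]
    [IsProbabilityMeasure F'] {κ η : ℝ} (hκ : 0 < κ) (hFF' : LipschitzClose η F F')
    {a b : Fin (J + 1) → ℝ} (h : ∀ d, |a d - b d| ≤ κ) (d : Fin (J + 1)) :
    F.real {e | regret a d e ≤ 0} ≤ F'.real {e | regret b d e ≤ 3 * κ} + 2 * η / κ := by
  -- A ramp equal to `κ` where the regret under `b` is at most `2κ`, and to `0` from `3κ` on. Moving
  -- the utilities by `κ` moves the regret by at most `2κ`, so `g = κ` on the region of `a`. Regret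
  -- is `2`-Lipschitz in the shocks, so half of `g` is an admissible test function; hence the error
  -- `2 * η / κ`.
  set g : (Fin J → ℝ) → ℝ := fun e => max 0 (min κ (3 * κ - regret b d e)) with hg
  have hgc : Continuous g := continuous_const.max
    (continuous_const.min (continuous_const.sub (continuous_regret b d)))
  have hg0 : ∀ e, 0 ≤ g e := fun e => le_max_left _ _
  have hgκ : ∀ e, g e ≤ κ := fun e => max_le hκ.le (min_le_left _ _)
  have hgi : ∀ (F : Measure (Fin J → ℝ)) [IsProbabilityMeasure F], Integrable g F := fun F _ =>
    Integrable.of_bound hgc.aestronglyMeasurable κ (ae_of_all _ fun e => by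
      rw [Real.norm_eq_abs, abs_of_nonneg (hg0 e)]; exact hgκ e)
  have hlip : LipschitzWith 1 fun e => (1 / 2) * g e := by
    refine LipschitzWith.of_dist_le_mul fun e e' => ?_
    have h1 := abs_regret_sub_le (a := b) (b := b) (κ := 0) (by simp) d e e'
    have h2 : |g e - g e'| ≤ |regret b d e - regret b d e'| := by
      calc |g e - g e'| ≤ |min κ (3 * κ - regret b d e) - min κ (3 * κ - regret b d e')| := by
            simp only [hg, max_comm (0 : ℝ)]; exact abs_max_sub_max_le_abs _ _ _
        _ ≤ max |κ - κ| |(3 * κ - regret b d e) - (3 * κ - regret b d e')| :=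
            abs_min_sub_min_le_max _ _ _ _
        _ = _ := by
            rw [sub_self, abs_zero, max_eq_right (abs_nonneg _), abs_sub_comm]
            congr 1; ring
    rw [Real.dist_eq, ← mul_sub, abs_mul, abs_of_pos (by norm_num : (0 : ℝ) < 1 / 2)]
    push_cast
    linarith
  have hclose := hFF' _ hlip
  rw [integral_const_mul, integral_const_mul] at hclose
  have h3 := (abs_le.1 hclose).2
  have hm : ∀ (b : Fin (J + 1) → ℝ) (c : ℝ), MeasurableSet {e | regret b d e ≤ c} := fun b c =>
    (isClosed_le (continuous_regret b d) continuous_const).measurableSet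
  have h4 : κ * F.real {e | regret a d e ≤ 0} ≤ ∫ e, g e ∂F := by
    have : κ * F.real {e | regret a d e ≤ 0}
        = ∫ e, Set.indicator {e | regret a d e ≤ 0} (fun _ => κ) e ∂F := by
      rw [integral_indicator_const _ (hm a 0), smul_eq_mul, mul_comm]
    rw [this]
    refine integral_mono ((integrable_const _).indicator (hm a 0)) (hgi F) fun e => ?_
    refine Set.indicator_le' (fun e he => ?_) (fun e _ => hg0 e) e
    have he : regret a d e ≤ 0 := he
    have := (abs_le.1 (abs_regret_sub_le h d e e)).1
    rw [dist_self] at this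
    exact le_max_of_le_right (le_min le_rfl (by linarith))
  have h5 : ∫ e, g e ∂F' ≤ κ * F'.real {e | regret b d e ≤ 3 * κ} := by
    have : κ * F'.real {e | regret b d e ≤ 3 * κ}
        = ∫ e, Set.indicator {e | regret b d e ≤ 3 * κ} (fun _ => κ) e ∂F' := by
      rw [integral_indicator_const _ (hm b _), smul_eq_mul, mul_comm]
    rw [this]
    refine integral_mono (hgi F') ((integrable_const _).indicator (hm b _)) fun e => ?_
    refine Set.le_indicator (fun e _ => hgκ e) (fun e he => ?_) e
    have he : ¬regret b d e ≤ 3 * κ := he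
    exact max_le le_rfl ((min_le_right _ _).trans (by linarith [not_le.1 he]))
  rw [← sub_le_iff_le_add', le_div_iff₀ hκ]
  nlinarith

/-- Continuity of `F` from above: the relaxed regions decrease to the choice region. -/
theorem exists_relaxation_le {J : ℕ} (F : Measure (Fin J → ℝ)) [IsProbabilityMeasure F]
    (a : Fin (J + 1) → ℝ) (d : Fin (J + 1)) {ε : ℝ} (hε : 0 < ε) :
    ∃ κ₀ : ℝ, 0 < κ₀ ∧ ∀ κ, 0 < κ → κ ≤ κ₀ →
      F.real {e | regret a d e ≤ 3 * κ} ≤ F.real {e | regret a d e ≤ 0} + ε := by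
  have hm : ∀ c : ℝ, MeasurableSet {e | regret a d e ≤ c} := fun c =>
    (isClosed_le (continuous_regret a d) continuous_const).measurableSet
  set s : ℕ → Set (Fin J → ℝ) := fun n => {e | regret a d e ≤ 3 * (1 / ((n : ℝ) + 1))} with hs
  have hanti : Antitone s := fun m n hmn e he =>
    le_trans (show regret a d e ≤ 3 * (1 / ((n : ℝ) + 1)) from he)
      (mul_le_mul_of_nonneg_left (Nat.one_div_le_one_div hmn) (by norm_num))
  have hinter : ⋂ n, s n = {e | regret a d e ≤ 0} := by
    ext e
    simp only [Set.mem_iInter, hs, Set.mem_ofPred_eq]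
    refine ⟨fun h => ?_, fun h n => h.trans (by positivity)⟩
    have hlim : Filter.Tendsto (fun n : ℕ => 3 * (1 / ((n : ℝ) + 1))) Filter.atTop
        (nhds (3 * 0)) := tendsto_one_div_add_atTop_nhds_zero_nat.const_mul 3
    rw [mul_zero] at hlim
    exact ge_of_tendsto' hlim h
  have ht : Filter.Tendsto (fun n => F.real (s n)) Filter.atTop
      (nhds (F.real {e | regret a d e ≤ 0})) := by
    rw [← hinter]
    exact (ENNReal.tendsto_toReal (measure_ne_top _ _)).comp
      (tendsto_measure_iInter_atTop (fun n => (hm _).nullMeasurableSet) hanti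
        ⟨0, measure_ne_top _ _⟩)
  obtain ⟨n, hn⟩ := (ht.eventually_lt_const (lt_add_of_pos_right _ hε)).exists
  refine ⟨1 / ((n : ℝ) + 1), by positivity, fun κ _ hκ => le_trans ?_ hn.le⟩
  exact measureReal_mono fun e he => le_trans (show regret a d e ≤ 3 * κ from he) (by linarith)

/-! ### Stability of the Emax function and of the choice probabilities -/

namespace ChoiceModel

variable {J K p : ℕ} (M : ChoiceModel J K p)

theorem bellman_emax (θ : EuclideanSpace ℝ (Fin p)) (F : Measure (Fin J → ℝ))
    [IsProbabilityMeasure F] (hF : ∀ j, Integrable (fun e : Fin J → ℝ => e j) F) :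
    M.bellman θ F (M.emax θ F) = M.emax θ F :=
  Classical.epsilon_spec (M.existsUnique_bellman θ F hF).exists

theorem abs_value_sub_le {θ θ' : EuclideanSpace ℝ (Fin p)} {η : ℝ}
    (hu : ∀ x d, |M.u x d θ - M.u x d θ'| ≤ η) (Q R : Fin K → ℝ) (x : Fin K) (d : Fin (J + 1)) :
    |M.value θ Q x d - M.value θ' R x d| ≤ η + M.beta * dist Q R := by
  have hs : |∑ y, M.G d x y * Q y - ∑ y, M.G d x y * R y| ≤ dist Q R := by
    rw [← Finset.sum_sub_distrib]
    calc |∑ y, (M.G d x y * Q y - M.G d x y * R y)|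
        ≤ ∑ y, |M.G d x y * Q y - M.G d x y * R y| := Finset.abs_sum_le_sum_abs _ _
      _ ≤ ∑ y, M.G d x y * dist Q R := by
          refine Finset.sum_le_sum fun y _ => ?_
          rw [← mul_sub, abs_mul, abs_of_nonneg (M.G_nonneg d x y)]
          exact mul_le_mul_of_nonneg_left (dist_le_pi_dist Q R y) (M.G_nonneg d x y)
      _ = dist Q R := by rw [← Finset.sum_mul, M.G_sum, one_mul]
  have h : M.value θ Q x d - M.value θ' R x d = (M.u x d θ - M.u x d θ')
      + M.beta * (∑ y, M.G d x y * Q y - ∑ y, M.G d x y * R y) := by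
    unfold value; ring
  rw [h]
  refine (abs_add_le _ _).trans (add_le_add (hu x d) ?_)
  rw [abs_mul, abs_of_nonneg M.beta_nonneg]
  exact mul_le_mul_of_nonneg_left hs M.beta_nonneg

/-- Perturbation of a contraction's fixed point: changing the utilities and changing the shock law
each move the Bellman operator by at most `η`, and the factor `1 / (1 - β)` sums the geometric
series. -/
theorem dist_emax_le {θ θ' : EuclideanSpace ℝ (Fin p)} {F F' : Measure (Fin J → ℝ)}
    [IsProbabilityMeasure F] [IsProbabilityMeasure F']
    (hF : ∀ j, Integrable (fun e : Fin J → ℝ => e j) F)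
    (hF' : ∀ j, Integrable (fun e : Fin J → ℝ => e j) F') {η : ℝ} (hη : 0 ≤ η)
    (hu : ∀ x d, |M.u x d θ - M.u x d θ'| ≤ η) (hFF' : LipschitzClose η F F') :
    dist (M.emax θ F) (M.emax θ' F') ≤ 2 * η / (1 - M.beta) := by
  set Q := M.emax θ F
  set R := M.emax θ' F'
  have hb : 0 < 1 - M.beta := by linarith [M.beta_lt_one]
  suffices h : dist Q R ≤ 2 * η + M.beta * dist Q R by
    rw [le_div_iff₀ hb]; linarith
  have hpos : 0 ≤ 2 * η + M.beta * dist Q R :=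
    add_nonneg (by linarith) (mul_nonneg M.beta_nonneg dist_nonneg)
  refine (dist_pi_le_iff hpos).2 fun x => ?_
  have hQ : Q x = ∫ e, maxUtility (M.value θ Q x) e ∂F :=
    (congrFun (M.bellman_emax θ F hF) x).symm
  have hR : R x = ∫ e, maxUtility (M.value θ' R x) e ∂F' :=
    (congrFun (M.bellman_emax θ' F' hF') x).symm
  rw [Real.dist_eq, hQ, hR]
  have h1 := hFF' _ (lipschitzWith_maxUtility (M.value θ' R x))
  have h2 : |∫ e, maxUtility (M.value θ Q x) e ∂F - ∫ e, maxUtility (M.value θ' R x) e ∂F|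
      ≤ η + M.beta * dist Q R := by
    rw [← integral_sub (integrable_maxUtility hF _) (integrable_maxUtility hF _)]
    have := norm_integral_le_of_norm_le_const (μ := F)
      (f := fun e => maxUtility (M.value θ Q x) e - maxUtility (M.value θ' R x) e)
      (C := η + M.beta * dist Q R) (ae_of_all _ fun e => by
        simpa using abs_maxUtility_sub_le (M.abs_value_sub_le hu Q R x) e e)
    simpa using this
  have := (abs_sub_le _ _ _).trans (add_le_add h2 h1)
  linarith

theorem ccp_eq (θ : EuclideanSpace ℝ (Fin p)) (F : Measure (Fin J → ℝ)) (x : Fin K)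
    (d : Fin (J + 1)) :
    M.ccp θ F x d = F.real {e | regret (M.value θ (M.emax θ F) x) d e ≤ 0} := by
  rw [← setOf_best_eq]; rfl

/-- Conditional choice probabilities are upper semicontinuous in utilities and in the shock
distribution. -/
theorem exists_ccp_le_add (θ' : EuclideanSpace ℝ (Fin p)) (F' : Measure (Fin J → ℝ))
    [IsProbabilityMeasure F'] (hF' : ∀ j, Integrable (fun e : Fin J → ℝ => e j) F')
    {ε : ℝ} (hε : 0 < ε) :
    ∃ η : ℝ, 0 < η ∧ ∀ (θ : EuclideanSpace ℝ (Fin p)) (F : Measure (Fin J → ℝ))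
      [IsProbabilityMeasure F], (∀ j, Integrable (fun e : Fin J → ℝ => e j) F) →
      (∀ x d, |M.u x d θ - M.u x d θ'| ≤ η) → LipschitzClose η F F' →
      ∀ x d, M.ccp θ F x d ≤ M.ccp θ' F' x d + ε := by
  have hκ : ∀ xd : Fin K × Fin (J + 1), ∀ᶠ κ in nhdsWithin (0 : ℝ) (Set.Ioi 0),
      F'.real {e | regret (M.value θ' (M.emax θ' F') xd.1) xd.2 e ≤ 3 * κ}
        ≤ F'.real {e | regret (M.value θ' (M.emax θ' F') xd.1) xd.2 e ≤ 0} + ε / 2 := by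
    intro xd
    obtain ⟨κ₀, h0, h⟩ := exists_relaxation_le F' (M.value θ' (M.emax θ' F') xd.1) xd.2
      (half_pos hε)
    filter_upwards [Ioc_mem_nhdsGT h0] with κ hκ using h κ hκ.1 hκ.2
  obtain ⟨κ, hκ, hκ0⟩ := ((Filter.eventually_all.2 hκ).and self_mem_nhdsWithin).exists
  have hκ0 : 0 < κ := hκ0
  have hb : 0 < 1 - M.beta := by linarith [M.beta_lt_one]
  -- The first bound keeps the values within `κ`: `η + β * 2η / (1 - β) ≤ κ (1 + β) / 3 ≤ κ`. The
  -- second makes the smoothing error `2 * η / κ` at most `ε / 2`; the other half of `ε` pays for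
  -- relaxing the region.
  refine ⟨min (κ * (1 - M.beta) / 3) (κ * ε / 4), by positivity, ?_⟩
  intro θ F _ hF hu hFF' x d
  set η := min (κ * (1 - M.beta) / 3) (κ * ε / 4) with hη
  have hη0 : 0 < η := by positivity
  have hη1 : η ≤ κ * (1 - M.beta) / 3 := min_le_left _ _
  have hη2 : η ≤ κ * ε / 4 := min_le_right _ _
  have hv : ∀ d, |M.value θ (M.emax θ F) x d - M.value θ' (M.emax θ' F') x d| ≤ κ := by
    intro d
    refine (M.abs_value_sub_le hu _ _ x d).trans ?_
    have h1 := M.dist_emax_le hF hF' hη0.le hu hFF'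
    rw [le_div_iff₀ hb] at h1
    have h2 : dist (M.emax θ F) (M.emax θ' F') ≤ 2 * κ / 3 := by
      refine le_of_mul_le_mul_right (h1.trans ?_) hb
      linarith
    have h3 := mul_le_mul_of_nonneg_left h2 M.beta_nonneg
    have h4 : κ * (1 - M.beta) / 3 + M.beta * (2 * κ / 3) ≤ κ := by
      nlinarith [M.beta_lt_one, M.beta_nonneg]
    linarith
  have h1 := measureReal_best_le hκ0 hFF' hv d
  have h2 := hκ (x, d)
  have h3 : 2 * η / κ ≤ ε / 2 := by
    rw [div_le_iff₀ hκ0]; linarith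
  rw [M.ccp_eq, M.ccp_eq]
  simp only at h2
  linarith

theorem ccp_nonneg (θ : EuclideanSpace ℝ (Fin p)) (F : Measure (Fin J → ℝ)) (x : Fin K)
    (d : Fin (J + 1)) : 0 ≤ M.ccp θ F x d := measureReal_nonneg

theorem ccp_le_one (θ : EuclideanSpace ℝ (Fin p)) (F : Measure (Fin J → ℝ))
    [IsProbabilityMeasure F] (x : Fin K) (d : Fin (J + 1)) : M.ccp θ F x d ≤ 1 :=
  measureReal_le_one

end ChoiceModel

/-! ### Ties are null, so choice probabilities sum to one -/

/-- The shock of a choice as a linear functional. -/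
def shockLinear {J : ℕ} (d : Fin (J + 1)) : (Fin J → ℝ) →ₗ[ℝ] ℝ where
  toFun e := shock e d
  map_add' e e' := by refine Fin.cases ?_ (fun j => ?_) d <;> simp [shock]
  map_smul' c e := by refine Fin.cases ?_ (fun j => ?_) d <;> simp [shock]

theorem shockLinear_sub_ne_zero {J : ℕ} {i j : Fin (J + 1)} (hij : i ≠ j) :
    shockLinear i - shockLinear j ≠ 0 := by
  have key : ∀ (k : Fin J) (j : Fin (J + 1)), k.succ ≠ j → shockLinear k.succ - shockLinear j ≠ 0 := by
    intro k j hkj h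
    have h1 := LinearMap.congr_fun h (Pi.single k 1)
    revert h1 hkj
    refine Fin.cases ?_ (fun l => ?_) j
    · simp [shockLinear, shock]
    · intro hkl
      have : l ≠ k := fun h => hkl (by rw [h])
      simp [shockLinear, shock, this]
  rcases Fin.eq_zero_or_eq_succ i with rfl | ⟨k, rfl⟩
  · obtain ⟨l, rfl⟩ := Fin.exists_succ_eq.2 hij.symm
    rw [← neg_sub, neg_ne_zero]
    exact key l 0 hij.symm
  · exact key k j hij

/-- Two given choices almost never tie under Lebesgue measure. -/
theorem volume_tie_eq_zero {J : ℕ} (a : Fin (J + 1) → ℝ) {i j : Fin (J + 1)} (hij : i ≠ j) :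
    volume {e : Fin J → ℝ | a i + shock e i = a j + shock e j} = 0 := by
  set ℓ : (Fin J → ℝ) →ₗ[ℝ] ℝ := shockLinear i - shockLinear j with hℓ
  have hℓe : ∀ e, ℓ e = shock e i - shock e j := fun e => rfl
  rcases Set.eq_empty_or_nonempty {e : Fin J → ℝ | a i + shock e i = a j + shock e j} with h | ⟨e₀, h⟩
  · rw [h, measure_empty]
  · have h : a i + shock e₀ i = a j + shock e₀ j := h
    -- The tie set is a translate of the kernel of a nonzero functional, a proper subspace.
    have heq : {e : Fin J → ℝ | a i + shock e i = a j + shock e j}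
        = (fun e => e + -e₀) ⁻¹' (LinearMap.ker ℓ : Set (Fin J → ℝ)) := by
      ext e
      simp only [Set.mem_ofPred_eq, Set.mem_preimage, SetLike.mem_coe, LinearMap.mem_ker]
      rw [← sub_eq_add_neg, map_sub, hℓe, hℓe]
      constructor <;> intro <;> linarith
    rw [heq, measure_preimage_add_right]
    refine Measure.addHaar_submodule _ _ fun htop => shockLinear_sub_ne_zero hij ?_
    exact LinearMap.ker_eq_top.1 htop

/-- The choice regions cover the space because a maximum is attained, and two of them meet only in
ties. -/
theorem sum_measureReal_best_eq_one {J : ℕ} {F : Measure (Fin J → ℝ)} [IsProbabilityMeasure F]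
    (hF : F ≪ volume) (a : Fin (J + 1) → ℝ) :
    ∑ d, F.real {e | regret a d e ≤ 0} = 1 := by
  have hm : ∀ d, MeasurableSet {e | regret a d e ≤ 0} := fun d =>
    (isClosed_le (continuous_regret a d) continuous_const).measurableSet
  have hU : ⋃ d, {e | regret a d e ≤ 0} = Set.univ := by
    refine Set.eq_univ_of_forall fun e => ?_
    obtain ⟨d, -, hd⟩ := Finset.exists_mem_eq_sup' (Finset.univ_nonempty (α := Fin (J + 1)))
      (fun d => a d + shock e d)
    exact Set.mem_iUnion.2 ⟨d, sub_nonpos.2 hd.le⟩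
  have h := measure_iUnion₀ (μ := F) (f := fun d => {e | regret a d e ≤ 0}) ?_
    fun d => (hm d).nullMeasurableSet
  · rw [hU, measure_univ, tsum_fintype] at h
    simp only [measureReal_def]
    rw [← ENNReal.toReal_sum fun d _ => measure_ne_top _ _, ← h, ENNReal.toReal_one]
  · intro i j hij
    refine measure_mono_null (fun e he => ?_) (hF (volume_tie_eq_zero a hij))
    have h1 : regret a i e ≤ 0 := he.1
    have h2 : regret a j e ≤ 0 := he.2
    have h3 := le_maxUtility a e i
    have h4 := le_maxUtility a e j
    unfold regret at h1 h2
    exact le_antisymm (by linarith) (by linarith)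

theorem ChoiceModel.sum_ccp {J K p : ℕ} (M : ChoiceModel J K p) (θ : EuclideanSpace ℝ (Fin p))
    {F : Measure (Fin J → ℝ)} [IsProbabilityMeasure F] (hF : F ≪ volume) (x : Fin K) :
    ∑ d, M.ccp θ F x d = 1 := by
  simp only [M.ccp_eq]
  exact sum_measureReal_best_eq_one hF _

/-! ### The univariate Gumbel density -/

theorem continuous_gumbel : Continuous gumbel := by
  unfold gumbel; fun_prop

theorem gumbel_nonneg (z : ℝ) : 0 ≤ gumbel z := (Real.exp_pos _).le

/-- An integrable majorant. The exponential factor is at most `2 * exp(-|s|)`; for negative `s` this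
uses `y ^ 2 / 2 ≤ exp y` at `y = exp(-s)`. The polynomial `1 + t + t² + t³` is at most `(0! + 1! +
2! + 3!) * exp t = 10 * exp t`. -/
theorem one_add_abs_mul_exp_sub_exp_le (s : ℝ) :
    (1 + |s|) * Real.exp (-s - Real.exp (-s)) ≤ 20 * (1 + s ^ 2)⁻¹ := by
  have h1 : Real.exp (-s - Real.exp (-s)) ≤ 2 * Real.exp (-|s|) := by
    rcases le_total 0 s with hs | hs
    · rw [abs_of_nonneg hs]
      have : Real.exp (-s - Real.exp (-s)) ≤ Real.exp (-s) :=
        Real.exp_le_exp.2 (by linarith [Real.exp_pos (-s)])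
      linarith [Real.exp_pos (-s)]
    · rw [abs_of_nonpos hs, neg_neg]
      have h := Real.pow_div_factorial_le_exp (Real.exp (-s)) (Real.exp_pos _).le 2
      rw [Real.exp_sub, div_le_iff₀ (Real.exp_pos _)]
      have h2 : Real.exp s * Real.exp (-s) = 1 := by rw [← Real.exp_add]; simp
      norm_num at h
      calc Real.exp (-s) = Real.exp s * (Real.exp (-s)) ^ 2 := by
            rw [pow_two, ← mul_assoc, h2, one_mul]
        _ ≤ Real.exp s * (2 * Real.exp (Real.exp (-s))) :=
            mul_le_mul_of_nonneg_left (by linarith) (Real.exp_pos _).le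
        _ = _ := by ring
  set t := |s| with ht
  have ht0 : 0 ≤ t := abs_nonneg s
  have h2 : (1 + t) * (1 + s ^ 2) ≤ 10 * Real.exp t := by
    have e1 := Real.pow_div_factorial_le_exp t ht0 1
    have e2 := Real.pow_div_factorial_le_exp t ht0 2
    have e3 := Real.pow_div_factorial_le_exp t ht0 3
    have e0 := Real.one_le_exp ht0
    norm_num [Nat.factorial] at e1 e2 e3
    rw [← sq_abs s, ← ht]
    nlinarith
  have h3 : 0 < 1 + s ^ 2 := by positivity
  rw [← div_eq_mul_inv, le_div_iff₀ h3]
  calc (1 + t) * Real.exp (-s - Real.exp (-s)) * (1 + s ^ 2)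
      = ((1 + t) * (1 + s ^ 2)) * Real.exp (-s - Real.exp (-s)) := by ring
    _ ≤ (10 * Real.exp t) * (2 * Real.exp (-t)) :=
        mul_le_mul h2 h1 (Real.exp_pos _).le (by positivity)
    _ = 20 * (Real.exp t * Real.exp (-t)) := by ring
    _ = 20 := by rw [← Real.exp_add]; simp

theorem integrable_one_add_abs_mul_gumbel :
    Integrable fun z : ℝ => (1 + |z + Real.eulerMascheroniConstant|) * gumbel z := by
  have h : Integrable fun s : ℝ => (1 + |s|) * Real.exp (-s - Real.exp (-s)) := by
    refine (integrable_inv_one_add_sq.const_mul 20).mono'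
      (by fun_prop : Continuous _).aestronglyMeasurable (ae_of_all _ fun s => ?_)
    rw [Real.norm_eq_abs, abs_of_nonneg (by positivity)]
    exact one_add_abs_mul_exp_sub_exp_le s
  convert h.comp_add_right Real.eulerMascheroniConstant using 2 with z
  simp only [gumbel, neg_add']

theorem integrable_gumbel : Integrable gumbel := by
  refine integrable_one_add_abs_mul_gumbel.mono' continuous_gumbel.aestronglyMeasurable
    (ae_of_all _ fun z => ?_)
  rw [Real.norm_eq_abs, abs_of_nonneg (gumbel_nonneg z)]
  exact le_mul_of_one_le_left (gumbel_nonneg z) (le_add_of_nonneg_right (abs_nonneg _))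

theorem integrable_id_mul_gumbel : Integrable fun z : ℝ => z * gumbel z := by
  refine (integrable_one_add_abs_mul_gumbel.add
    (integrable_gumbel.const_mul |Real.eulerMascheroniConstant|)).mono'
    (continuous_id.mul continuous_gumbel).aestronglyMeasurable (ae_of_all _ fun z => ?_)
  rw [norm_mul, Real.norm_eq_abs, Real.norm_eq_abs, abs_of_nonneg (gumbel_nonneg z),
    Pi.add_apply, ← add_mul]
  refine mul_le_mul_of_nonneg_right ?_ (gumbel_nonneg z)
  have := abs_sub (z + Real.eulerMascheroniConstant) Real.eulerMascheroniConstant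
  rw [add_sub_cancel_right] at this
  linarith

/-- The distribution function `exp(-exp(-z - γ))` is a primitive with limits `0` and `1`. -/
theorem integral_gumbel : ∫ z, gumbel z = 1 := by
  have hd : ∀ z : ℝ, HasDerivAt
      (fun z => Real.exp (-Real.exp (-z - Real.eulerMascheroniConstant))) (gumbel z) z := by
    intro z
    have h1 : HasDerivAt (fun z : ℝ => -z - Real.eulerMascheroniConstant) (-1) z :=
      (hasDerivAt_neg z).sub_const _
    refine h1.exp.neg.exp.congr_deriv ?_
    change _ = Real.exp (-z - Real.eulerMascheroniConstant
      - Real.exp (-z - Real.eulerMascheroniConstant))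
    rw [sub_eq_add_neg (-z - Real.eulerMascheroniConstant), Real.exp_add]
    simp only [Pi.neg_apply]
    ring
  have hlin : ∀ z : ℝ, -z - Real.eulerMascheroniConstant = -(z + Real.eulerMascheroniConstant) :=
    fun z => by ring
  have hbot : Filter.Tendsto (fun z : ℝ => Real.exp (-Real.exp (-z - Real.eulerMascheroniConstant)))
      Filter.atBot (nhds 0) := by
    simp only [hlin]
    exact Real.tendsto_exp_neg_atTop_nhds_zero.comp (Real.tendsto_exp_atTop.comp
      (Filter.tendsto_neg_atBot_atTop.comp (Filter.tendsto_atBot_add_const_right _ _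
        Filter.tendsto_id)))
  have htop : Filter.Tendsto (fun z : ℝ => Real.exp (-Real.exp (-z - Real.eulerMascheroniConstant)))
      Filter.atTop (nhds 1) := by
    simp only [hlin]
    have h : Filter.Tendsto (fun z : ℝ => -Real.exp (-(z + Real.eulerMascheroniConstant)))
        Filter.atTop (nhds (-0)) := (Real.tendsto_exp_neg_atTop_nhds_zero.comp
      (Filter.tendsto_atTop_add_const_right _ _ Filter.tendsto_id)).neg
    rw [neg_zero] at h
    have h2 := (Real.continuous_exp.tendsto 0).comp h
    rwa [Real.exp_zero] at h2
  simpa using integral_of_hasDerivAt_of_tendsto hd integrable_gumbel hbot htop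

/-! ### Gumbel laws and their mixtures -/

/-- The law of `J` independent Gumbel variables. -/
noncomputable def gumbelLaw (J : ℕ) : Measure (Fin J → ℝ) :=
  volume.withDensity fun z => ENNReal.ofReal (∏ j, gumbel (z j))

theorem measurable_prod_gumbel (J : ℕ) :
    Measurable fun z : Fin J → ℝ => ENNReal.ofReal (∏ j, gumbel (z j)) :=
  (ENNReal.continuous_ofReal.comp (continuous_finsetProd _ fun j _ =>
    continuous_gumbel.comp (continuous_apply j))).measurable

instance isProbabilityMeasure_gumbelLaw (J : ℕ) : IsProbabilityMeasure (gumbelLaw J) := by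
  constructor
  rw [gumbelLaw, withDensity_apply _ MeasurableSet.univ, Measure.restrict_univ, volume_pi,
    ← ofReal_integral_eq_lintegral_ofReal
      (Integrable.fintype_prod (f := fun _ : Fin J => gumbel) fun _ => integrable_gumbel)
      (ae_of_all _ fun z => Finset.prod_nonneg fun j _ => gumbel_nonneg _),
    ← volume_pi, integral_fintype_prod_volume_eq_pow, integral_gumbel, one_pow, ENNReal.ofReal_one]

theorem integrable_coord_gumbelLaw {J : ℕ} (j : Fin J) :
    Integrable (fun z : Fin J → ℝ => z j) (gumbelLaw J) := by
  rw [gumbelLaw, integrable_withDensity_iff (measurable_prod_gumbel J)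
    (ae_of_all _ fun _ => ENNReal.ofReal_lt_top)]
  have h := Integrable.fintype_prod (μ := fun _ : Fin J => (volume : Measure ℝ))
    (f := fun i z => if i = j then z * gumbel z else gumbel z)
    (fun i => by by_cases h : i = j <;> simp [h, integrable_gumbel, integrable_id_mul_gumbel])
  rw [← volume_pi] at h
  convert h using 2 with z
  rw [ENNReal.toReal_ofReal (Finset.prod_nonneg fun j _ => gumbel_nonneg _),
    ← Finset.mul_prod_erase _ _ (Finset.mem_univ j),
    ← Finset.mul_prod_erase _ (fun i => if i = j then z i * gumbel (z i) else gumbel (z i))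
      (Finset.mem_univ j), if_pos rfl, mul_assoc]
  congr 2
  exact Finset.prod_congr rfl fun i hi => (if_neg (Finset.ne_of_mem_erase hi)).symm

theorem integrable_norm_of_coord {J : ℕ} {F : Measure (Fin J → ℝ)}
    (hF : ∀ j, Integrable (fun e : Fin J → ℝ => e j) F) :
    Integrable (fun e : Fin J → ℝ => ‖e‖) F := by
  refine (integrable_finsetSum Finset.univ fun j _ => (hF j).norm).mono'
    continuous_norm.aestronglyMeasurable (ae_of_all _ fun e => ?_)
  rw [norm_norm]
  exact (pi_norm_le_iff_of_nonneg (Finset.sum_nonneg fun _ _ => norm_nonneg _)).2 fun j =>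
    Finset.single_le_sum (f := fun j => ‖e j‖) (fun _ _ => norm_nonneg _) (Finset.mem_univ j)

theorem LipschitzWith.integrable_of_coord {J : ℕ} {F : Measure (Fin J → ℝ)} [IsProbabilityMeasure F]
    (hF : ∀ j, Integrable (fun e : Fin J → ℝ => e j) F) {g : (Fin J → ℝ) → ℝ}
    (hg : LipschitzWith 1 g) : Integrable g F := by
  refine ((integrable_const |g 0|).add (integrable_norm_of_coord hF)).mono'
    hg.continuous.aestronglyMeasurable (ae_of_all _ fun e => ?_)
  have := hg.dist_le_mul e 0
  rw [Real.dist_eq, dist_zero_right] at this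
  have h2 := abs_sub_abs_le_abs_sub (g e) (g 0)
  simp only [NNReal.coe_one, one_mul] at this
  simp only [Real.norm_eq_abs, Pi.add_apply]
  linarith

/-- Change of variables with Jacobian `σ ^ J`. Every mixture component becomes an affine image of
one fixed law, so parameters enter integrals only through the integrand. -/
theorem map_gumbelLaw {J : ℕ} (μ : Fin J → ℝ) {σ : ℝ} (hσ : 0 < σ) :
    (gumbelLaw J).map (fun v => μ + σ • v) =
      volume.withDensity fun z => ENNReal.ofReal (gumbelDensity μ σ z) := by
  have hT : Measurable fun v : Fin J → ℝ => μ + σ • v := by fun_prop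
  have hc : Continuous (gumbelDensity μ σ) := by
    unfold gumbelDensity
    exact continuous_finsetProd _ fun j _ => continuous_const.mul
      (continuous_gumbel.comp (by fun_prop))
  have hvol : (volume : Measure (Fin J → ℝ)).map (fun v => μ + σ • v)
      = ENNReal.ofReal |(σ ^ J)⁻¹| • volume := by
    have : (fun v : Fin J → ℝ => μ + σ • v) = (fun v => μ + v) ∘ fun v => σ • v := rfl
    rw [this, ← Measure.map_map (by fun_prop) (by fun_prop), Measure.map_addHaar_smul _ hσ.ne',
      Measure.map_smul, map_add_left_eq_self]
    simp
  have hdens : ∀ v : Fin J → ℝ, ENNReal.ofReal (∏ j, gumbel (v j))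
      = ENNReal.ofReal (σ ^ J) * ENNReal.ofReal (gumbelDensity μ σ (μ + σ • v)) := by
    intro v
    rw [← ENNReal.ofReal_mul (by positivity)]
    congr 1
    simp only [gumbelDensity, Pi.add_apply, Pi.smul_apply, smul_eq_mul, add_sub_cancel_left,
      mul_div_cancel_left₀ _ hσ.ne', Finset.prod_mul_distrib, Finset.prod_const,
      Finset.card_univ, Fintype.card_fin]
    rw [← mul_assoc, ← mul_pow, mul_one_div_cancel hσ.ne', one_pow, one_mul]
  ext s hs
  rw [Measure.map_apply hT hs, gumbelLaw, withDensity_apply _ (hT hs), withDensity_apply _ hs]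
  simp only [hdens]
  rw [lintegral_const_mul _ (by
    exact (ENNReal.continuous_ofReal.comp (hc.comp (by fun_prop))).measurable),
    ← setLIntegral_map (f := fun z => ENNReal.ofReal (gumbelDensity μ σ z)) hs
      (ENNReal.continuous_ofReal.comp hc).measurable hT, hvol,
    Measure.restrict_smul, lintegral_smul_measure, smul_eq_mul, ← mul_assoc,
    ← ENNReal.ofReal_mul (by positivity), abs_of_pos (by positivity),
    mul_inv_cancel₀ (by positivity), ENNReal.ofReal_one, one_mul]

theorem mixtureLaw_eq_sum {J : ℕ} (q : Mixture J) :
    mixtureLaw q = ∑ k, ENNReal.ofReal (q.2.1.2.2 k) •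
      (gumbelLaw J).map fun v => q.2.1.1 k + q.2.1.2.1 k • v := by
  have hc : ∀ k, Measurable fun z =>
      ENNReal.ofReal (gumbelDensity (q.2.1.1 k) (q.2.1.2.1 k) z) := fun k => by
    refine (ENNReal.continuous_ofReal.comp ?_).measurable
    unfold gumbelDensity
    exact continuous_finsetProd _ fun j _ => continuous_const.mul
      (continuous_gumbel.comp (by fun_prop))
  have hd : ∀ k z, 0 ≤ gumbelDensity (q.2.1.1 k) (q.2.1.2.1 k) z := fun k z =>
    Finset.prod_nonneg fun j _ => mul_nonneg (one_div_pos.2 (q.2.2.1 k)).le (gumbel_nonneg _)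
  ext s hs
  rw [mixtureLaw, withDensity_apply _ hs, Measure.finsetSum_apply]
  simp only [Measure.smul_apply, smul_eq_mul, map_gumbelLaw _ (q.2.2.1 _), withDensity_apply _ hs]
  simp only [ENNReal.ofReal_sum_of_nonneg fun k _ => mul_nonneg (q.2.2.2.1 k) (hd k _),
    ENNReal.ofReal_mul (q.2.2.2.1 _)]
  rw [lintegral_finsetSum _ fun k _ => (hc k).const_mul _]
  exact Finset.sum_congr rfl fun k _ => lintegral_const_mul _ (hc k)

instance isProbabilityMeasure_mixtureLaw {J : ℕ} (q : Mixture J) :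
    IsProbabilityMeasure (mixtureLaw q) := by
  constructor
  rw [mixtureLaw_eq_sum, Measure.finsetSum_apply]
  simp only [Measure.smul_apply, smul_eq_mul]
  have : ∀ k, (gumbelLaw J).map (fun v => q.2.1.1 k + q.2.1.2.1 k • v) Set.univ = 1 := fun k => by
    rw [Measure.map_apply (by fun_prop) MeasurableSet.univ, Set.preimage_univ, measure_univ]
  simp only [this, mul_one]
  rw [← ENNReal.ofReal_sum_of_nonneg fun k _ => q.2.2.2.1 k, q.2.2.2.2, ENNReal.ofReal_one]

theorem mixtureLaw_absolutelyContinuous {J : ℕ} (q : Mixture J) : mixtureLaw q ≪ volume :=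
  withDensity_absolutelyContinuous _ _

theorem integrable_comp_affine_gumbelLaw {J : ℕ} {g : (Fin J → ℝ) → ℝ} (hg : LipschitzWith 1 g)
    (μ : Fin J → ℝ) (σ : ℝ) : Integrable (fun v => g (μ + σ • v)) (gumbelLaw J) := by
  have hn := integrable_norm_of_coord (F := gumbelLaw J) integrable_coord_gumbelLaw
  refine ((integrable_const |g μ|).add (hn.const_mul |σ|)).mono'
    (hg.continuous.comp (by fun_prop)).aestronglyMeasurable (ae_of_all _ fun e => ?_)
  have := hg.dist_le_mul (μ + σ • e) μ
  rw [Real.dist_eq, dist_self_add_left, norm_smul, Real.norm_eq_abs] at this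
  have h2 := abs_sub_abs_le_abs_sub (g (μ + σ • e)) (g μ)
  simp only [NNReal.coe_one, one_mul] at this
  simp only [Real.norm_eq_abs, Pi.add_apply]
  linarith

theorem integrable_mixtureLaw {J : ℕ} {g : (Fin J → ℝ) → ℝ} (hg : LipschitzWith 1 g)
    (q : Mixture J) : Integrable g (mixtureLaw q) := by
  rw [mixtureLaw_eq_sum, integrable_finsetSum_measure]
  intro k _
  refine Integrable.smul_measure ?_ ENNReal.ofReal_ne_top
  rw [integrable_map_measure hg.continuous.aestronglyMeasurable (by fun_prop)]
  exact integrable_comp_affine_gumbelLaw hg _ _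

theorem integrable_coord_mixtureLaw {J : ℕ} (q : Mixture J) (j : Fin J) :
    Integrable (fun e : Fin J → ℝ => e j) (mixtureLaw q) :=
  integrable_mixtureLaw (LipschitzWith.eval j) q

theorem integral_mixtureLaw {J : ℕ} {g : (Fin J → ℝ) → ℝ} (hg : LipschitzWith 1 g)
    (q : Mixture J) : ∫ e, g e ∂mixtureLaw q =
      ∑ k, q.2.1.2.2 k * ∫ v, g (q.2.1.1 k + q.2.1.2.1 k • v) ∂gumbelLaw J := by
  rw [mixtureLaw_eq_sum, integral_finsetSum_measure]
  · refine Finset.sum_congr rfl fun k _ => ?_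
    rw [integral_smul_measure, ENNReal.toReal_ofReal (q.2.2.2.1 k), smul_eq_mul,
      integral_map (by fun_prop) hg.continuous.aestronglyMeasurable]
  · intro k _
    refine Integrable.smul_measure ?_ ENNReal.ofReal_ne_top
    rw [integrable_map_measure hg.continuous.aestronglyMeasurable (by fun_prop)]
    exact integrable_comp_affine_gumbelLaw hg _ _

/-- A coupling: both images use the same `v`. The scale may be `0`, so point masses are included. -/
theorem abs_integral_affine_sub_le {J : ℕ} {g : (Fin J → ℝ) → ℝ} (hg : LipschitzWith 1 g)
    (μ μ' : Fin J → ℝ) (σ σ' : ℝ) :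
    |∫ v, g (μ + σ • v) ∂gumbelLaw J - ∫ v, g (μ' + σ' • v) ∂gumbelLaw J| ≤
      dist μ μ' + |σ - σ'| * ∫ v, ‖v‖ ∂gumbelLaw J := by
  have hn := integrable_norm_of_coord (F := gumbelLaw J) integrable_coord_gumbelLaw
  rw [← integral_sub (integrable_comp_affine_gumbelLaw hg _ _)
    (integrable_comp_affine_gumbelLaw hg _ _)]
  have hb : ∫ v, (dist μ μ' + |σ - σ'| * ‖v‖) ∂gumbelLaw J
      = dist μ μ' + |σ - σ'| * ∫ v, ‖v‖ ∂gumbelLaw J := by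
    rw [integral_add (integrable_const _) (hn.const_mul _), integral_const_mul]
    simp
  rw [← hb, ← Real.norm_eq_abs]
  refine norm_integral_le_of_norm_le ((integrable_const _).add (hn.const_mul _))
    (ae_of_all _ fun v => ?_)
  rw [← Real.dist_eq]
  refine (hg.dist_le_mul _ _).trans ?_
  rw [NNReal.coe_one, one_mul]
  refine (dist_add_add_le _ _ _ _).trans (add_le_add le_rfl ?_)
  rw [dist_eq_norm, ← sub_smul, norm_smul]
  rfl

/-- Gumbel mixtures depend continuously on their parameters. -/
theorem exists_lipschitzClose_of_mem_ball {J m : ℕ} (q' : MixtureParam J m) {η : ℝ} (hη : 0 < η) :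
    ∃ δ : ℝ, 0 < δ ∧ ∀ q ∈ Metric.ball q' δ,
      LipschitzClose η (mixtureLaw ⟨m, q⟩) (mixtureLaw ⟨m, q'⟩) := by
  set E := ∫ v, ‖v‖ ∂gumbelLaw J with hE
  have hE0 : 0 ≤ E := integral_nonneg fun v => norm_nonneg v
  -- `B k` bounds the distance of the `k`-th component of `q'` from the point mass at `0`. Moving
  -- locations and scales will cost `δ * (1 + E)`, moving weights `δ * ∑ k, B k`.
  set B : Fin m → ℝ := fun k => ‖q'.1.1 k‖ + |q'.1.2.1 k| * E with hB
  have hB0 : ∀ k, 0 ≤ B k := fun k => by positivity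
  have hS : 0 ≤ ∑ k, B k := Finset.sum_nonneg fun k _ => hB0 k
  have hC : 0 < 1 + E + ∑ k, B k := by linarith
  refine ⟨η / (1 + E + ∑ k, B k), by positivity, fun q hq g hg => ?_⟩
  set δ := η / (1 + E + ∑ k, B k) with hδ
  have hd : dist q q' < δ := hq
  rw [Subtype.dist_eq, Prod.dist_eq, Prod.dist_eq] at hd
  have hμ : ∀ k, dist (q.1.1 k) (q'.1.1 k) ≤ δ := fun k =>
    (dist_le_pi_dist _ _ k).trans ((le_max_left _ _).trans hd.le)
  have hσ : ∀ k, |q.1.2.1 k - q'.1.2.1 k| ≤ δ := fun k =>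
    (dist_le_pi_dist q.1.2.1 q'.1.2.1 k).trans
      ((le_max_left _ _).trans ((le_max_right _ _).trans hd.le))
  have hw : ∀ k, |q.1.2.2 k - q'.1.2.2 k| ≤ δ := fun k =>
    (dist_le_pi_dist q.1.2.2 q'.1.2.2 k).trans
      ((le_max_right _ _).trans ((le_max_right _ _).trans hd.le))
  rw [integral_mixtureLaw hg, integral_mixtureLaw hg]
  simp only
  set I := fun k => ∫ v, g (q.1.1 k + q.1.2.1 k • v) ∂gumbelLaw J
  set I' := fun k => ∫ v, g (q'.1.1 k + q'.1.2.1 k • v) ∂gumbelLaw J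
  have hI : ∀ k, |I k - I' k| ≤ δ * (1 + E) := fun k => by
    refine (abs_integral_affine_sub_le hg _ _ _ _).trans ?_
    have := mul_le_mul_of_nonneg_right (hσ k) hE0
    linarith [hμ k]
  have hI' : ∀ k, |I' k - g 0| ≤ B k := fun k => by
    have := abs_integral_affine_sub_le hg (q'.1.1 k) 0 (q'.1.2.1 k) 0
    simpa using this
  -- Both weight vectors sum to one, so `g 0` may be subtracted. This is needed because `g` is
  -- controlled only up to an additive constant.
  have hsplit : ∑ k, q.1.2.2 k * I k - ∑ k, q'.1.2.2 k * I' k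
      = ∑ k, (q.1.2.2 k * (I k - I' k) + (q.1.2.2 k - q'.1.2.2 k) * (I' k - g 0)) := by
    have h1 : ∑ k, (q.1.2.2 k - q'.1.2.2 k) * g 0 = 0 := by
      rw [← Finset.sum_mul, Finset.sum_sub_distrib, q.2.2.2, q'.2.2.2, sub_self, zero_mul]
    have h2 : ∑ k, q.1.2.2 k * I k - ∑ k, q'.1.2.2 k * I' k = ∑ k, q.1.2.2 k * I k
        - ∑ k, q'.1.2.2 k * I' k - ∑ k, (q.1.2.2 k - q'.1.2.2 k) * g 0 := by
      rw [h1, sub_zero]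
    rw [h2, ← Finset.sum_sub_distrib, ← Finset.sum_sub_distrib]
    exact Finset.sum_congr rfl fun k _ => by ring
  rw [hsplit]
  calc |∑ k, (q.1.2.2 k * (I k - I' k) + (q.1.2.2 k - q'.1.2.2 k) * (I' k - g 0))|
      ≤ ∑ k, |q.1.2.2 k * (I k - I' k) + (q.1.2.2 k - q'.1.2.2 k) * (I' k - g 0)| :=
        Finset.abs_sum_le_sum_abs _ _
    _ ≤ ∑ k, (q.1.2.2 k * (δ * (1 + E)) + δ * B k) := by
        refine Finset.sum_le_sum fun k _ => (abs_add_le _ _).trans (add_le_add ?_ ?_)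
        · rw [abs_mul, abs_of_nonneg (q.2.2.1 k)]
          exact mul_le_mul_of_nonneg_left (hI k) (q.2.2.1 k)
        · rw [abs_mul]
          exact mul_le_mul (hw k) (hI' k) (abs_nonneg _) (by positivity)
    _ = δ * (1 + E + ∑ k, B k) := by
        rw [Finset.sum_add_distrib, ← Finset.sum_mul, q.2.2.2, ← Finset.mul_sum]; ring
    _ = η := div_mul_cancel₀ _ hC.ne'

/-- Every law with a finite first moment is a limit of Gumbel mixtures. -/
theorem exists_mixtureLaw_lipschitzClose {J : ℕ} (F : Measure (Fin J → ℝ)) [IsProbabilityMeasure F]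
    (hF : ∀ j, Integrable (fun e : Fin J → ℝ => e j) F) {η : ℝ} (hη : 0 < η) :
    ∃ (m : ℕ) (q : MixtureParam J m), LipschitzClose η (mixtureLaw ⟨m, q⟩) F := by
  have hid : Integrable (fun e : Fin J → ℝ => e) F :=
    (integrable_norm_iff aestronglyMeasurable_id).1 (integrable_norm_of_coord hF)
  -- Quantization: a simple function `L¹`-close to the identity pushes `F` to a finitely supported
  -- law within `η / 2` of it.
  obtain ⟨n, hn⟩ := ((SimpleFunc.tendsto_approxOn_range_L1_enorm measurable_id
    hid).eventually_lt_const (ENNReal.ofReal_pos.2 (half_pos hη))).exists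
  set s : SimpleFunc (Fin J → ℝ) (Fin J → ℝ) :=
    SimpleFunc.approxOn id measurable_id (Set.range id ∪ {0}) 0 (by simp) n with hs
  have hsi : Integrable s F := s.integrable_of_isFiniteMeasure
  have hdist : ∫ z, ‖s z - z‖ ∂F ≤ η / 2 := by
    rw [integral_norm_eq_lintegral_enorm (f := fun z => s z - z)
      (hsi.sub hid).aestronglyMeasurable]
    exact ENNReal.toReal_le_of_le_ofReal (half_pos hη).le hn.le
  set E := ∫ v, ‖v‖ ∂gumbelLaw J with hE
  have hE0 : 0 ≤ E := integral_nonneg fun v => norm_nonneg v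
  -- A scale at which spreading each atom costs at most `η / 2`; the `+ 1` avoids division by zero.
  set σ := η / (2 * (E + 1)) with hσ
  have hσ0 : 0 < σ := by positivity
  have hσE : σ * E ≤ η / 2 := by
    rw [hσ, div_mul_eq_mul_div, div_le_div_iff₀ (by positivity) (by norm_num)]
    nlinarith
  set c := s.range.equivFin.symm with hc
  set w : Fin s.range.card → ℝ := fun k => F.real (s ⁻¹' {(c k : Fin J → ℝ)}) with hw
  have hsum : ∀ g : (Fin J → ℝ) → ℝ, ∑ k, w k * g (c k) = ∫ z, g (s z) ∂F := by
    intro g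
    have hpt : ∀ z, g (s z) = ∑ k, (s ⁻¹' {(c k : Fin J → ℝ)}).indicator (fun _ => g (c k)) z := by
      intro z
      rw [Finset.sum_eq_single (c.symm ⟨s z, s.mem_range_self z⟩)]
      · simp
      · intro k _ hk
        refine Set.indicator_of_notMem (fun hz => hk ?_) _
        rw [Equiv.eq_symm_apply]
        exact Subtype.ext (Eq.symm hz)
      · simp
    simp only [hpt]
    rw [integral_finsetSum _ fun k _ => (integrable_const _).indicator (s.measurableSet_preimage _)]
    refine Finset.sum_congr rfl fun k _ => ?_
    rw [integral_indicator_const _ (s.measurableSet_preimage _), smul_eq_mul]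
  have hw1 : ∑ k, w k = 1 := by simpa using hsum fun _ => 1
  refine ⟨s.range.card, ⟨(fun k => c k, fun _ => σ, w), fun _ => hσ0,
    fun k => measureReal_nonneg, hw1⟩, fun g hg => ?_⟩
  rw [integral_mixtureLaw hg]
  simp only
  have h1 : |∑ k, w k * ∫ v, g (c k + σ • v) ∂gumbelLaw J - ∫ z, g (s z) ∂F| ≤ η / 2 := by
    rw [← hsum g, ← Finset.sum_sub_distrib]
    calc |∑ k, (w k * ∫ v, g (c k + σ • v) ∂gumbelLaw J - w k * g (c k))|
        ≤ ∑ k, |w k * ∫ v, g (c k + σ • v) ∂gumbelLaw J - w k * g (c k)| :=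
          Finset.abs_sum_le_sum_abs _ _
      _ ≤ ∑ k, w k * (σ * E) := by
          refine Finset.sum_le_sum fun k _ => ?_
          rw [← mul_sub, abs_mul, abs_of_nonneg measureReal_nonneg]
          refine mul_le_mul_of_nonneg_left ?_ measureReal_nonneg
          simpa [abs_of_pos hσ0] using abs_integral_affine_sub_le hg (c k) (c k) σ 0
      _ = σ * E := by rw [← Finset.sum_mul, hw1, one_mul]
      _ ≤ η / 2 := hσE
  have h2 : |∫ z, g (s z) ∂F - ∫ z, g z ∂F| ≤ η / 2 := by
    have hgi := hg.integrable_of_coord hF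
    have hgs : Integrable (fun z => g (s z)) F := (s.map g).integrable_of_isFiniteMeasure
    rw [← integral_sub hgs hgi, ← Real.norm_eq_abs]
    refine (norm_integral_le_of_norm_le (hsi.sub hid).norm (ae_of_all _ fun z => ?_)).trans hdist
    simpa [Real.dist_eq, dist_eq_norm] using hg.dist_le_mul (s z) z
  have := abs_sub_le (∑ k, w k * ∫ v, g (c k + σ • v) ∂gumbelLaw J) (∫ z, g (s z) ∂F)
    (∫ z, g z ∂F)
  linarith

/-! ### Choices given states under the law of a history -/

namespace ChoiceModel

variable {J K p : ℕ} (M : ChoiceModel J K p)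

theorem historyProb_snoc {T : ℕ} (θ : EuclideanSpace ℝ (Fin p)) (F : Measure (Fin J → ℝ))
    (h : History J K T) (s : Fin K × Fin (J + 1)) :
    M.historyProb θ F (Fin.snoc h s : History J K (T + 1)) = M.historyProb θ F h *
      (M.ccp θ F s.1 s.2 * M.G (h (Fin.last T)).2 (h (Fin.last T)).1 s.1) := by
  have h0 : (Fin.snoc h s : History J K (T + 1)) 0 = h 0 := by
    rw [← Fin.castSucc_zero (n := T + 1)]
    exact Fin.snoc_castSucc (α := fun _ => Fin K × Fin (J + 1)) s h 0
  have hc : ∀ t, (Fin.snoc h s : History J K (T + 1)) (Fin.castSucc t) = h t := fun t =>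
    Fin.snoc_castSucc (α := fun _ => Fin K × Fin (J + 1)) s h t
  have hl : (Fin.snoc h s : History J K (T + 1)) (Fin.last (T + 1)) = s :=
    Fin.snoc_last (α := fun _ => Fin K × Fin (J + 1)) s h
  unfold historyProb
  rw [h0, Fin.prod_univ_castSucc (n := T + 1), Fin.prod_univ_castSucc (n := T)
    (fun t => M.G _ _ _)]
  simp only [hc, hl, Fin.succ_last, Fin.succ_castSucc]
  ring

theorem sum_history_succ {T : ℕ} (g : History J K (T + 1) → ℝ) :
    ∑ h, g h = ∑ h : History J K T, ∑ s, g (Fin.snoc h s) := by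
  rw [← (Fin.snocEquiv fun _ => Fin K × Fin (J + 1)).sum_comp g, Fintype.sum_prod_type,
    Finset.sum_comm]
  rfl

theorem sum_ccp_mul {θ : EuclideanSpace ℝ (Fin p)} {F : Measure (Fin J → ℝ)}
    (hsum : ∀ x, ∑ d, M.ccp θ F x d = 1) (a : Fin K → ℝ) :
    ∑ s : Fin K × Fin (J + 1), M.ccp θ F s.1 s.2 * a s.1 = ∑ x, a x := by
  rw [Fintype.sum_prod_type]
  refine Finset.sum_congr rfl fun x _ => ?_
  simp only
  rw [← Finset.sum_mul, hsum, one_mul]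

/-- The one-period case; `a` will be the initial distribution or a row of transition probabilities.
-/
theorem sum_ccp_mul_ite {θ : EuclideanSpace ℝ (Fin p)} {F : Measure (Fin J → ℝ)}
    (hsum : ∀ x, ∑ d, M.ccp θ F x d = 1) (a : Fin K → ℝ) (x : Fin K) (d : Fin (J + 1)) :
    ∑ s : Fin K × Fin (J + 1), (M.ccp θ F s.1 s.2 * a s.1) * (if s = (x, d) then 1 else 0) =
      M.ccp θ F x d * ∑ s : Fin K × Fin (J + 1),
        (M.ccp θ F s.1 s.2 * a s.1) * (if s.1 = x then 1 else 0) := by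
  simp only [mul_assoc]
  rw [M.sum_ccp_mul hsum fun y => a y * if y = x then 1 else 0]
  simp

/-- In every period, the choice probabilities given the state are the conditional choice
probabilities. -/
theorem sum_historyProb_mul_ite {θ : EuclideanSpace ℝ (Fin p)} {F : Measure (Fin J → ℝ)}
    (hsum : ∀ x, ∑ d, M.ccp θ F x d = 1) (x : Fin K) (d : Fin (J + 1)) :
    ∀ {T : ℕ} (t : Fin (T + 1)),
    ∑ h : History J K T, M.historyProb θ F h * (if h t = (x, d) then 1 else 0) =
      M.ccp θ F x d * ∑ h : History J K T,
        M.historyProb θ F h * (if (h t).1 = x then 1 else 0) := by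
  intro T
  induction T with
  | zero =>
    intro t
    have hp : ∀ s : Fin K × Fin (J + 1), M.historyProb θ F (fun _ : Fin 1 => s)
        = M.ccp θ F s.1 s.2 * M.init s.1 := fun s => by
      simp [historyProb, mul_comm]
    rw [← (Equiv.funUnique (Fin 1) (Fin K × Fin (J + 1))).symm.sum_comp,
      ← (Equiv.funUnique (Fin 1) (Fin K × Fin (J + 1))).symm.sum_comp]
    have he : ∀ s, (Equiv.funUnique (Fin 1) (Fin K × Fin (J + 1))).symm s = fun _ => s :=
      fun s => rfl
    simp only [he, hp]
    exact M.sum_ccp_mul_ite hsum M.init x d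
  | succ T ih =>
    intro t
    rw [sum_history_succ, sum_history_succ]
    simp only [historyProb_snoc]
    -- In the last period the choice factors out of the innermost sum; for an earlier one the last
    -- period sums to one and the induction hypothesis applies.
    induction t using Fin.lastCases with
    | last =>
      rw [Finset.mul_sum]
      refine Finset.sum_congr rfl fun h _ => ?_
      have hl : ∀ s, (Fin.snoc h s : History J K (T + 1)) (Fin.last (T + 1)) = s := fun s =>
        Fin.snoc_last (α := fun _ => Fin K × Fin (J + 1)) s h
      simp only [hl, mul_assoc (M.historyProb θ F h), ← Finset.mul_sum]
      rw [M.sum_ccp_mul_ite hsum (fun y => M.G (h (Fin.last T)).2 (h (Fin.last T)).1 y)]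
      ring
    | cast t =>
      have hc : ∀ (h : History J K T) s, (Fin.snoc h s : History J K (T + 1)) (Fin.castSucc t)
          = h t := fun h s => Fin.snoc_castSucc (α := fun _ => Fin K × Fin (J + 1)) s h t
      simp only [hc, ← Finset.sum_mul, ← Finset.mul_sum]
      have h1 : ∀ h : History J K T, ∑ s : Fin K × Fin (J + 1), M.ccp θ F s.1 s.2
          * M.G (h (Fin.last T)).2 (h (Fin.last T)).1 s.1 = 1 := fun h => by
        rw [M.sum_ccp_mul hsum fun y => M.G (h (Fin.last T)).2 (h (Fin.last T)).1 y, M.G_sum]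
      simp only [h1, mul_one]
      exact ih t

end ChoiceModel

/-! ### Frequencies of observations -/

theorem measureReal_eq_sum_ite {Ω α : Type*} [MeasurableSpace Ω] [Fintype α] [MeasurableSpace α]
    [MeasurableSingletonClass α] (ℙ : Measure Ω) [IsProbabilityMeasure ℙ] {D : Ω → α}
    (hD : Measurable D) (P : α → Prop) [DecidablePred P] :
    ℙ.real {ω | P (D ω)} = ∑ h, ℙ.real {ω | D ω = h} * (if P h then 1 else 0) := by
  have h := sum_measureReal_preimage_singleton (μ := ℙ) (Finset.univ.filter P) (f := D)
    fun y _ => hD (measurableSet_singleton y)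
  simp only [mul_ite, mul_one, mul_zero, ← Finset.sum_filter]
  simp only [Finset.coe_filter, Finset.mem_univ, true_and] at h
  exact h.symm

/-- The strong law of large numbers for the frequencies of observations in i.i.d. histories. -/
theorem ae_tendsto_frequency {J K T : ℕ} {Ω : Type*} [MeasurableSpace Ω] (ℙ : Measure Ω)
    [IsProbabilityMeasure ℙ] (D : ℕ → Ω → History J K T) (hDmeas : ∀ i, Measurable (D i))
    (hDindep : ProbabilityTheory.iIndepFun D ℙ)
    (hDlaw : ∀ i h, ℙ.real {ω | D i ω = h} = ℙ.real {ω | D 0 ω = h}) :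
    ∀ᵐ ω ∂ℙ, ∀ s, Filter.Tendsto
      (fun n : ℕ => (∑ i ∈ Finset.range n, ∑ t, if D i ω t = s then (1 : ℝ) else 0) / n)
      Filter.atTop (nhds (∑ t, ℙ.real {ω | D 0 ω t = s})) := by
  rw [ae_all_iff]
  intro s
  set φ : History J K T → ℝ := fun h => ∑ t, if h t = s then (1 : ℝ) else 0 with hφ
  have hφm : Measurable φ := measurable_of_finite φ
  have hident : ∀ i, ProbabilityTheory.IdentDistrib (D i) (D 0) ℙ ℙ := fun i => by
    refine ⟨(hDmeas i).aemeasurable, (hDmeas 0).aemeasurable, ?_⟩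
    refine Measure.ext_of_singleton fun h => ?_
    rw [Measure.map_apply (hDmeas i) (measurableSet_singleton h),
      Measure.map_apply (hDmeas 0) (measurableSet_singleton h)]
    exact (measureReal_eq_measureReal_iff).1 (hDlaw i h)
  have hint : Integrable (fun ω => φ (D 0 ω)) ℙ := by
    refine Integrable.of_bound (hφm.comp (hDmeas 0)).aestronglyMeasurable (∑ _t : Fin (T + 1), 1)
      (ae_of_all _ fun ω => ?_)
    refine (norm_sum_le _ _).trans (Finset.sum_le_sum fun t _ => ?_)
    split_ifs <;> simp
  have hmean : ∫ ω, φ (D 0 ω) ∂ℙ = ∑ t, ℙ.real {ω | D 0 ω t = s} := by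
    have hm : ∀ t, MeasurableSet {ω | D 0 ω t = s} := fun t =>
      ((measurable_pi_apply t).comp (hDmeas 0)) (measurableSet_singleton s)
    have hpt : ∀ ω, φ (D 0 ω) = ∑ t, Set.indicator {ω | D 0 ω t = s} (fun _ => (1 : ℝ)) ω :=
      fun ω => by simp [hφ, Set.indicator_apply]
    simp only [hpt]
    rw [integral_finsetSum _ fun t _ => (integrable_const _).indicator (hm t)]
    refine Finset.sum_congr rfl fun t _ => ?_
    rw [integral_indicator_const _ (hm t), smul_eq_mul, mul_one]
  have h := ProbabilityTheory.strong_law_ae_real (μ := ℙ) (fun i ω => φ (D i ω)) hint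
    (fun i j hij => (hDindep.indepFun hij).comp hφm hφm)
    (fun i => (hident i).comp hφm)
  rw [hmean] at h
  exact h

/-! ### Likelihood ratio bounds -/

/-- The likelihood of choice probabilities `π` for the first `n` histories. -/
noncomputable def choiceLikelihood {S : Type*} {T : ℕ} (π : S → ℝ) (n : ℕ)
    (D : ℕ → Fin (T + 1) → S) : ℝ :=
  ∏ i ∈ Finset.range n, ∏ t, π (D i t)

theorem choiceLikelihood_pos {S : Type*} {T : ℕ} {π₀ : S → ℝ} {D : ℕ → Fin (T + 1) → S}
    (hD : ∀ i t, 0 < π₀ (D i t)) (n : ℕ) : 0 < choiceLikelihood π₀ n D :=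
  Finset.prod_pos fun i _ => Finset.prod_pos fun t _ => hD i t

theorem exists_le_of_forall_pos {α : Type*} [Finite α] (f : α → ℝ) (hf : ∀ a, 0 < f a) :
    ∃ c : ℝ, 0 < c ∧ ∀ a, c ≤ f a := by
  have h : ∀ᶠ c in nhdsWithin (0 : ℝ) (Set.Ioi 0), ∀ a, c ≤ f a :=
    Filter.eventually_all.2 fun a => by
      filter_upwards [Ioc_mem_nhdsGT (hf a)] with c hc using hc.2
  obtain ⟨c, hc, hc0⟩ := (h.and self_mem_nhdsWithin).exists
  exact ⟨c, hc0, hc⟩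

/-- Choice probabilities that are not much smaller than `π₀` have a likelihood that is, on the
exponential scale, not much smaller than that of `π₀`. -/
theorem exists_exp_mul_le_choiceLikelihood {S : Type*} [Finite S] (T : ℕ) (π₀ : S → ℝ) {a : ℝ}
    (ha : 0 < a) :
    ∃ ε : ℝ, 0 < ε ∧ ∀ (D : ℕ → Fin (T + 1) → S), (∀ i t, 0 < π₀ (D i t)) → ∀ π : S → ℝ,
      (∀ s, π₀ s ≤ π s + ε) → ∀ n : ℕ,
        Real.exp (-(n * a)) * choiceLikelihood π₀ n D ≤ choiceLikelihood π n D := by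
  -- A history has `T + 1` factors, and each may lose `exp(-b)`.
  set b := a / (T + 1) with hb
  have hb0 : 0 < b := by positivity
  have hexp : 0 < 1 - Real.exp (-b) := by
    have : Real.exp (-b) < 1 := by simpa using hb0
    linarith
  -- Only cells with `π₀ s > 0` are observed, and their finitely many probabilities are bounded away
  -- from `0`.
  obtain ⟨ε, hε, hεle⟩ := exists_le_of_forall_pos (α := {s // 0 < π₀ s})
    (fun s => (1 - Real.exp (-b)) * π₀ s) fun s => mul_pos hexp s.2
  refine ⟨ε, hε, fun D hD π hπ n => ?_⟩
  have hle : ∀ i t, Real.exp (-b) * π₀ (D i t) ≤ π (D i t) := fun i t => by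
    have h1 := hεle ⟨_, hD i t⟩
    have h2 := hπ (D i t)
    simp only at h1
    linarith
  calc Real.exp (-(n * a)) * choiceLikelihood π₀ n D
      = ∏ i ∈ Finset.range n, ∏ t, Real.exp (-b) * π₀ (D i t) := by
        simp only [Finset.prod_mul_distrib, Finset.prod_const, Finset.card_range,
          Finset.card_univ, Fintype.card_fin, choiceLikelihood]
        congr 1
        rw [← pow_mul, ← Real.exp_nat_mul, hb]
        congr 1
        push_cast
        field_simp
    _ ≤ choiceLikelihood π n D :=
        Finset.prod_le_prod
          (fun i _ => Finset.prod_nonneg fun t _ => mul_nonneg (Real.exp_pos _).le (hD i t).le)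
          fun i _ => Finset.prod_le_prod (fun t _ => mul_nonneg (Real.exp_pos _).le (hD i t).le)
            fun t _ => hle i t

/-- This is `log r ≤ 2 (√r - 1)`. Unlike the logarithm, the right side stays bounded as `r → 0`, so
no lower bound on competing probabilities is needed. -/
theorem le_mul_exp_sqrt_div {a b : ℝ} (ha : 0 ≤ a) (hb : 0 < b) :
    a ≤ b * Real.exp (2 * (√(a / b) - 1)) := by
  have h1 : √(a / b) ≤ Real.exp (√(a / b) - 1) := by
    have := Real.add_one_le_exp (√(a / b) - 1)
    linarith
  have h2 : a / b ≤ Real.exp (2 * (√(a / b) - 1)) := by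
    calc a / b = √(a / b) ^ 2 := (Real.sq_sqrt (by positivity)).symm
      _ ≤ Real.exp (√(a / b) - 1) ^ 2 := pow_le_pow_left₀ (Real.sqrt_nonneg _) h1 2
      _ = _ := by rw [← Real.exp_nat_mul]; norm_num
  rwa [div_le_iff₀' hb] at h2

/-- A pointwise version of the bound of the Kullback-Leibler divergence by a squared distance. -/
theorem mul_sqrt_div_sub_one_le {a b : ℝ} (ha : 0 ≤ a) (ha1 : a ≤ 1) (hb : 0 ≤ b) (hb1 : b ≤ 1) :
    b * (2 * (√(a / b) - 1)) ≤ a - b - (b - a) ^ 2 / 4 := by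
  obtain ⟨x, hx, rfl⟩ : ∃ x, 0 ≤ x ∧ a = x ^ 2 := ⟨√a, Real.sqrt_nonneg a, (Real.sq_sqrt ha).symm⟩
  obtain ⟨y, hy, rfl⟩ : ∃ y, 0 ≤ y ∧ b = y ^ 2 := ⟨√b, Real.sqrt_nonneg b, (Real.sq_sqrt hb).symm⟩
  have hx1 : x ≤ 1 := by nlinarith
  have hy1 : y ≤ 1 := by nlinarith
  rw [Real.sqrt_div (by positivity), Real.sqrt_sq hx, Real.sqrt_sq hy]
  have h1 : y ^ 2 * (2 * (x / y - 1)) = 2 * x * y - 2 * y ^ 2 := by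
    rcases hy.eq_or_lt with rfl | hy
    · simp
    · field_simp
  -- The left side of the goal is `a - b - (√a - √b)²`, and `√a + √b ≤ 2` gives `(b - a)² ≤ 4 (√b -
  -- √a)²`.
  have h2 : (y ^ 2 - x ^ 2) ^ 2 ≤ 4 * (y - x) ^ 2 := by
    have : (y ^ 2 - x ^ 2) ^ 2 = (y + x) ^ 2 * (y - x) ^ 2 := by ring
    rw [this]
    refine mul_le_mul_of_nonneg_right ?_ (sq_nonneg _)
    nlinarith
  rw [h1]
  nlinarith

/-- Choice probabilities at a distance from the truth `π₀` have an exponentially small relative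
likelihood, uniformly, once the frequencies of observations are close to their limits. -/
theorem exists_choiceLikelihood_le {J K T : ℕ} (π₀ : Fin K × Fin (J + 1) → ℝ)
    (hπ₀ : ∀ s, 0 ≤ π₀ s ∧ π₀ s ≤ 1) (hπ₀sum : ∀ x, ∑ d, π₀ (x, d) = 1) (w : Fin K → ℝ)
    (hw : ∀ x, 0 < w x) {δ : ℝ} (hδ : 0 < δ) :
    ∃ a : ℝ, 0 < a ∧ ∀ (D : ℕ → History J K T), (∀ i t, 0 < π₀ (D i t)) →
      (∀ s, Filter.Tendsto
        (fun n : ℕ => (∑ i ∈ Finset.range n, ∑ t, if D i t = s then (1 : ℝ) else 0) / n)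
        Filter.atTop (nhds (π₀ s * w s.1))) →
      ∀ᶠ n : ℕ in Filter.atTop, ∀ π : Fin K × Fin (J + 1) → ℝ, (∀ s, 0 ≤ π s ∧ π s ≤ 1) →
        (∀ x, ∑ d, π (x, d) = 1) → δ ^ 2 < ∑ s, (π₀ s - π s) ^ 2 →
        choiceLikelihood π n D ≤ Real.exp (-(3 * (n * a))) * choiceLikelihood π₀ n D := by
  obtain ⟨w₀, hw₀, hww⟩ := exists_le_of_forall_pos w hw
  -- In the limit the loss is at least `w₀ * δ ^ 2 / 4 = 4a`; deviations of the frequencies cost at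
  -- most `a`, which leaves `3a`.
  set a := w₀ * δ ^ 2 / 16 with ha
  have ha0 : 0 < a := by positivity
  refine ⟨a, ha0, fun D hD hN => ?_⟩
  set N : ℕ → Fin K × Fin (J + 1) → ℝ := fun n s =>
    ∑ i ∈ Finset.range n, ∑ t, if D i t = s then (1 : ℝ) else 0 with hNdef
  -- A bound on the exponents below that does not depend on `π`; this makes the estimate uniform.
  set B : Fin K × Fin (J + 1) → ℝ := fun s => 2 * (√(1 / π₀ s) + 1) with hB
  have herr : Filter.Tendsto (fun n : ℕ => ∑ s, |N n s / n - π₀ s * w s.1| * B s)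
      Filter.atTop (nhds 0) := by
    have h : Filter.Tendsto (fun n : ℕ => ∑ s, |N n s / n - π₀ s * w s.1| * B s)
        Filter.atTop (nhds (∑ s, |π₀ s * w s.1 - π₀ s * w s.1| * B s)) :=
      tendsto_finsetSum _ fun s _ => (((hN s).sub_const _).abs).mul_const _
    simpa using h
  filter_upwards [herr.eventually_lt_const ha0, Filter.eventually_gt_atTop 0] with n hn hn0 π hπ
    hπsum hdist
  have hn0' : (0 : ℝ) < n := by exact_mod_cast hn0
  set φ : Fin K × Fin (J + 1) → ℝ := fun s => 2 * (√(π s / π₀ s) - 1) with hφ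
  have hφB : ∀ s, |φ s| ≤ B s := fun s => by
    have h1 : √(π s / π₀ s) ≤ √(1 / π₀ s) :=
      Real.sqrt_le_sqrt (div_le_div_of_nonneg_right (hπ s).2 (hπ₀ s).1)
    have h2 := Real.sqrt_nonneg (π s / π₀ s)
    simp only [hφ, hB]
    rw [abs_le]
    constructor <;> linarith
  have hcount : ∑ i ∈ Finset.range n, ∑ t, φ (D i t) = ∑ s, N n s * φ s := by
    have hpt : ∀ i t, φ (D i t) = ∑ s, (if D i t = s then (1 : ℝ) else 0) * φ s := fun i t => by
      simp
    simp only [hNdef, Finset.sum_mul]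
    refine Eq.trans (Finset.sum_congr rfl fun i _ => ?_) Finset.sum_comm
    exact Eq.trans (Finset.sum_congr rfl fun t _ => hpt i t) Finset.sum_comm
  have hlimit : ∑ s, π₀ s * w s.1 * φ s ≤ -(4 * a) := by
    have h1 : ∀ s, π₀ s * w s.1 * φ s ≤ w s.1 * (π s - π₀ s) - w₀ * ((π₀ s - π s) ^ 2 / 4) := by
      intro s
      have h := mul_le_mul_of_nonneg_left
        (mul_sqrt_div_sub_one_le (hπ s).1 (hπ s).2 (hπ₀ s).1 (hπ₀ s).2) (hw s.1).le
      have h' := mul_le_mul_of_nonneg_right (hww s.1)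
        (by positivity : 0 ≤ (π₀ s - π s) ^ 2 / 4)
      calc π₀ s * w s.1 * φ s = w s.1 * (π₀ s * (2 * (√(π s / π₀ s) - 1))) := by
            simp only [hφ]; ring
        _ ≤ _ := h
        _ ≤ _ := by rw [mul_sub (w s.1)]; linarith
    -- The linear terms cancel because both families of probabilities sum to one in each state.
    have h2 : ∑ s : Fin K × Fin (J + 1), w s.1 * (π s - π₀ s) = 0 := by
      rw [Fintype.sum_prod_type]
      refine Finset.sum_eq_zero fun x _ => ?_
      simp only
      rw [← Finset.mul_sum, Finset.sum_sub_distrib, hπsum, hπ₀sum, sub_self, mul_zero]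
    have h3 := Finset.sum_le_sum fun s (_ : s ∈ Finset.univ) => h1 s
    rw [Finset.sum_sub_distrib, h2, ← Finset.mul_sum, ← Finset.sum_div] at h3
    have h4 := mul_lt_mul_of_pos_left hdist hw₀
    rw [ha]
    linarith
  have hexp : ∑ s, N n s * φ s ≤ -(3 * (n * a)) := by
    have h1 : ∑ s, N n s / n * φ s ≤ -(3 * a) := by
      have h2 : ∑ s, (N n s / n - π₀ s * w s.1) * φ s
          ≤ ∑ s, |N n s / n - π₀ s * w s.1| * B s :=
        Finset.sum_le_sum fun s _ => (le_abs_self _).trans (by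
          rw [abs_mul]; exact mul_le_mul_of_nonneg_left (hφB s) (abs_nonneg _))
      simp only [sub_mul, Finset.sum_sub_distrib] at h2
      linarith
    have h3 : ∑ s, N n s * φ s = n * ∑ s, N n s / n * φ s := by
      rw [Finset.mul_sum]
      refine Finset.sum_congr rfl fun s _ => ?_
      field_simp
    rw [h3]
    nlinarith
  calc choiceLikelihood π n D
      ≤ ∏ i ∈ Finset.range n, ∏ t, π₀ (D i t) * Real.exp (φ (D i t)) :=
        Finset.prod_le_prod (fun i _ => Finset.prod_nonneg fun t _ => (hπ _).1) fun i _ =>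
          Finset.prod_le_prod (fun t _ => (hπ _).1) fun t _ =>
            le_mul_exp_sqrt_div (hπ _).1 (hD i t)
    _ = Real.exp (∑ i ∈ Finset.range n, ∑ t, φ (D i t)) * choiceLikelihood π₀ n D := by
        simp only [Finset.prod_mul_distrib, Real.exp_sum, choiceLikelihood]
        rw [mul_comm]
    _ ≤ _ := by
        rw [hcount]
        exact mul_le_mul_of_nonneg_right (Real.exp_le_exp.2 hexp)
          (choiceLikelihood_pos hD n).le

/-! ### The true shock law and the prior mass near it -/

theorem IsSmoothDensity.isProbabilityMeasure {J : ℕ} {f : (Fin J → ℝ) → ℝ}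
    (hf : IsSmoothDensity f) :
    IsProbabilityMeasure (volume.withDensity fun z => ENNReal.ofReal (f z)) := by
  constructor
  rw [withDensity_apply _ MeasurableSet.univ, Measure.restrict_univ,
    ← ofReal_integral_eq_lintegral_ofReal (integrable_of_integral_eq_one hf.integral_eq_one)
      (ae_of_all _ hf.nonneg), hf.integral_eq_one, ENNReal.ofReal_one]

theorem IsSmoothDensity.integrable_coord {J : ℕ} {f : (Fin J → ℝ) → ℝ}
    (hf : IsSmoothDensity f) (j : Fin J) :
    Integrable (fun e : Fin J → ℝ => e j)
      (volume.withDensity fun z => ENNReal.ofReal (f z)) := by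
  rw [integrable_withDensity_iff hf.measurable.ennreal_ofReal
    (ae_of_all _ fun _ => ENNReal.ofReal_lt_top)]
  simp only [ENNReal.toReal_ofReal (hf.nonneg _)]
  refine hf.moment.mono' ((measurable_pi_apply j).mul hf.measurable).aestronglyMeasurable
    (ae_of_all _ fun e => ?_)
  rw [norm_mul, Real.norm_of_nonneg (hf.nonneg e)]
  exact mul_le_mul_of_nonneg_right (PiLp.norm_apply_le (WithLp.toLp 2 e) j) (hf.nonneg e)

theorem measurableSet_sigma_mk_image {J m : ℕ} {s : Set (MixtureParam J m)}
    (hs : MeasurableSet s) : MeasurableSet (Sigma.mk m '' s : Set (Mixture J)) := by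
  refine MeasurableSpace.measurableSet_iInf.2 fun k => ?_
  change MeasurableSet (Sigma.mk k ⁻¹' (Sigma.mk m '' s : Set (Mixture J)))
  by_cases h : k = m
  · subst h
    rwa [Set.preimage_image_eq _ sigma_mk_injective]
  · convert MeasurableSet.empty
    ext q
    simp only [Set.mem_preimage, Set.mem_image, Set.mem_empty_iff_false, iff_false]
    rintro ⟨r, -, hr⟩
    exact h (congrArg Sigma.fst hr).symm

namespace ChoiceModel

variable {J K p : ℕ} (M : ChoiceModel J K p)

/-- The prior charges the parameters whose choice probabilities are at least `P(θ₀,F₀) - ε`. -/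
theorem exists_measurableSet_prior_pos (hu : ∀ x d, Continuous (M.u x d))
    (θ₀ : EuclideanSpace ℝ (Fin p)) (F₀ : Measure (Fin J → ℝ)) [IsProbabilityMeasure F₀]
    (hF₀ : ∀ j, Integrable (fun e : Fin J → ℝ => e j) F₀) (hac : F₀ ≪ volume)
    (prior : Measure (EuclideanSpace ℝ (Fin p) × Mixture J))
    (hprior : ∀ δ : ℝ, 0 < δ → ∀ (m : ℕ) (q : MixtureParam J m),
      0 < prior (Metric.ball θ₀ δ ×ˢ (Sigma.mk m '' Metric.ball q δ))) {ε : ℝ} (hε : 0 < ε) :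
    ∃ U, MeasurableSet U ∧ 0 < prior U ∧
      ∀ q ∈ U, ∀ x d, M.ccp θ₀ F₀ x d ≤ M.ccp q.1 (mixtureLaw q.2) x d + ε := by
  -- The lower bound for a choice comes from upper bounds for the `J` others, whose errors add up.
  -- Half of `η` pays for replacing `F₀` by a mixture, half for moving that mixture's parameters.
  obtain ⟨η, hη, hup⟩ := M.exists_ccp_le_add θ₀ F₀ hF₀ (ε := ε / (J + 1)) (by positivity)
  obtain ⟨m, q', hq'⟩ := exists_mixtureLaw_lipschitzClose F₀ hF₀ (half_pos hη)
  obtain ⟨δ₁, hδ₁, hball⟩ := exists_lipschitzClose_of_mem_ball q' (half_pos hη)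
  have hcont : ∀ᶠ θ in nhds θ₀, ∀ x d, |M.u x d θ - M.u x d θ₀| ≤ η := by
    refine Filter.eventually_all.2 fun x => Filter.eventually_all.2 fun d => ?_
    filter_upwards [Metric.tendsto_nhds.1 ((hu x d).tendsto θ₀) η hη] with θ hθ using hθ.le
  obtain ⟨δ₂, hδ₂, hθ⟩ := Metric.eventually_nhds_iff_ball.1 hcont
  have hδ : 0 < min δ₁ δ₂ := lt_min hδ₁ hδ₂
  refine ⟨_, ?_, hprior _ hδ m q', ?_⟩
  · exact Metric.isOpen_ball.measurableSet.prod
      (measurableSet_sigma_mk_image Metric.isOpen_ball.measurableSet)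
  · rintro ⟨θ, q⟩ ⟨hθm, r, hr, rfl⟩ x d
    have hclose := ((hball r (Metric.ball_subset_ball (min_le_left _ _) hr)).trans hq').mono
      (add_halves η).le
    have h := hup θ (mixtureLaw ⟨m, r⟩) (integrable_coord_mixtureLaw _)
      (hθ θ (Metric.ball_subset_ball (min_le_right _ _) hθm)) hclose x
    have h1 := M.sum_ccp θ (mixtureLaw_absolutelyContinuous ⟨m, r⟩) x
    have h2 := M.sum_ccp θ₀ hac x
    rw [← Finset.add_sum_erase _ _ (Finset.mem_univ d)] at h1 h2
    have h3 : ∑ j ∈ Finset.univ.erase d, M.ccp θ (mixtureLaw ⟨m, r⟩) x j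
        ≤ ∑ j ∈ Finset.univ.erase d, M.ccp θ₀ F₀ x j + ε := by
      refine (Finset.sum_le_sum fun j _ => h j).trans ?_
      rw [Finset.sum_add_distrib, Finset.sum_const, Finset.card_erase_of_mem (Finset.mem_univ d),
        Finset.card_univ, Fintype.card_fin, Nat.add_sub_cancel, nsmul_eq_mul]
      refine add_le_add le_rfl ?_
      rw [mul_div_assoc', div_le_iff₀ (by positivity)]
      nlinarith
    simp only
    linarith

end ChoiceModel

/-! ### Posterior consistency -/

theorem theorem1 {J K T p : ℕ} (M : ChoiceModel J K p)
    -- utilities are continuous in the parameter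
    (hu : ∀ x d, Continuous (M.u x d))
    -- the true parameter and the true shock distribution, with density `f₀`
    (θ₀ : EuclideanSpace ℝ (Fin p)) (F₀ : Measure (Fin J → ℝ)) (f₀ : (Fin J → ℝ) → ℝ)
    (hf₀ : IsSmoothDensity f₀)
    (hF₀ : F₀ = volume.withDensity fun z => ENNReal.ofReal (f₀ z))
    -- the data: i.i.d. histories generated by `(θ₀, F₀)`
    {Ω : Type*} [MeasurableSpace Ω] (ℙ : Measure Ω) [IsProbabilityMeasure ℙ]
    (D : ℕ → Ω → History J K T) (hDmeas : ∀ i, Measurable (D i))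
    (hDindep : ProbabilityTheory.iIndepFun D ℙ)
    (hDlaw : ∀ i h, ℙ.real {ω | D i ω = h} = M.historyProb θ₀ F₀ h)
    -- every state is visited with positive probability in some period
    (hvisit : ∀ i x, ∃ t, 0 < ℙ {ω | (D i ω t).1 = x})
    -- the prior on `(θ, m, (μ, σ, w))` charges, for every `m`, every neighbourhood of `θ₀` and of
    -- any `m`-component mixture parameters. If `θ` is independent of the mixture parameters, this
    -- says that the prior of `θ` charges every ball around `θ₀`, that each `m` has positive prior
    -- probability, and that the prior of the mixture parameters given `m` charges every ball.
    (prior : Measure (EuclideanSpace ℝ (Fin p) × Mixture J)) [IsProbabilityMeasure prior]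
    (hprior : ∀ δ : ℝ, 0 < δ → ∀ (m : ℕ) (q : MixtureParam J m),
      0 < prior (Metric.ball θ₀ δ ×ˢ (Sigma.mk m '' Metric.ball q δ))) :
    -- the posterior is well defined, and concentrates
    ∀ δ : ℝ, 0 < δ → ∀ᵐ ω ∂ℙ,
      (∀ n, M.evidence prior n (fun i => D i ω) ≠ 0 ∧ M.evidence prior n (fun i => D i ω) ≠ ⊤) ∧
      Filter.Tendsto
        (fun n => M.posterior prior n (fun i => D i ω)
          {q | δ < ‖M.ccpVec θ₀ F₀ - M.ccpVec q.1 (mixtureLaw q.2)‖})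
        Filter.atTop (nhds 0) := by
  intro δ hδ
  have hprob : IsProbabilityMeasure F₀ := hF₀ ▸ hf₀.isProbabilityMeasure
  have hint : ∀ j, Integrable (fun e : Fin J → ℝ => e j) F₀ := fun j =>
    hF₀ ▸ hf₀.integrable_coord j
  have hac : F₀ ≪ volume := hF₀ ▸ withDensity_absolutelyContinuous _ _
  have hsum := M.sum_ccp θ₀ hac
  set π₀ : Fin K × Fin (J + 1) → ℝ := fun s => M.ccp θ₀ F₀ s.1 s.2 with hπ₀
  set π : EuclideanSpace ℝ (Fin p) × Mixture J → Fin K × Fin (J + 1) → ℝ := fun q s =>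
    M.ccp q.1 (mixtureLaw q.2) s.1 s.2 with hπ
  have hπ01 : ∀ q s, 0 ≤ π q s ∧ π q s ≤ 1 := fun q s =>
    ⟨M.ccp_nonneg _ _ _ _, M.ccp_le_one _ _ _ _⟩
  set w : Fin K → ℝ := fun x => ∑ t, ℙ.real {ω | (D 0 ω t).1 = x} with hw
  have hw0 : ∀ x, 0 < w x := fun x => by
    obtain ⟨t, ht⟩ := hvisit 0 x
    exact Finset.sum_pos' (fun t _ => measureReal_nonneg)
      ⟨t, Finset.mem_univ t, ENNReal.toReal_pos ht.ne' (measure_ne_top _ _)⟩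
  have hmarg : ∀ i t s, ℙ.real {ω | D i ω t = s} = π₀ s * ℙ.real {ω | (D i ω t).1 = s.1} := by
    rintro i t ⟨x, d⟩
    rw [measureReal_eq_sum_ite ℙ (hDmeas i) fun h => h t = (x, d),
      measureReal_eq_sum_ite ℙ (hDmeas i) fun h => (h t).1 = x]
    simp only [hDlaw]
    exact M.sum_historyProb_mul_ite hsum x d t
  -- Almost surely no cell of true probability zero is observed, so the likelihood at the truth is
  -- positive and ratios to it make sense.
  have hpos : ∀ᵐ ω ∂ℙ, ∀ i t, 0 < π₀ (D i ω t) := by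
    have h : ∀ i t s, ∀ᵐ ω ∂ℙ, D i ω t = s → 0 < π₀ s := fun i t s => by
      by_cases hs : 0 < π₀ s
      · exact ae_of_all _ fun _ _ => hs
      · have h0 : π₀ s = 0 := le_antisymm (not_lt.1 hs) (M.ccp_nonneg _ _ _ _)
        have h1 := hmarg i t s
        rw [h0, zero_mul, measureReal_eq_zero_iff] at h1
        filter_upwards [measure_eq_zero_iff_ae_notMem.1 h1] with ω hω hD using absurd hD hω
    simp only [← ae_all_iff] at h
    filter_upwards [h] with ω hω i t using hω i t _ rfl
  have hfreq := ae_tendsto_frequency ℙ D hDmeas hDindep fun i h => by rw [hDlaw, hDlaw]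
  -- The separation `δ` fixes the rate `a`; then `ε`, and with it `U`, is chosen so that the
  -- evidence loses only `exp(-na)`.
  obtain ⟨a, ha, hupper⟩ := exists_choiceLikelihood_le (T := T) π₀
    (fun s => ⟨M.ccp_nonneg _ _ _ _, M.ccp_le_one _ _ _ _⟩) hsum w hw0 hδ
  obtain ⟨ε, hε, hlower⟩ := exists_exp_mul_le_choiceLikelihood T π₀ ha
  obtain ⟨U, hUm, hU0, hU⟩ := M.exists_measurableSet_prior_pos hu θ₀ F₀ hint hac prior hprior hε
  filter_upwards [hpos, hfreq] with ω hω hN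
  have hN' : ∀ s, Filter.Tendsto
      (fun n : ℕ => (∑ i ∈ Finset.range n, ∑ t, if D i ω t = s then (1 : ℝ) else 0) / n)
      Filter.atTop (nhds (π₀ s * w s.1)) := fun s => by
    have h := hN s
    simp only [hmarg 0, ← Finset.mul_sum] at h
    exact h
  have hlik : ∀ q n, M.likelihood q.1 (mixtureLaw q.2) n (fun i => D i ω)
      = choiceLikelihood (π q) n fun i => D i ω := fun q n => rfl
  set ℓ₀ : ℕ → ℝ := fun n => choiceLikelihood π₀ n fun i => D i ω with hℓ₀
  have hℓ₀pos : ∀ n, 0 < ℓ₀ n := choiceLikelihood_pos hω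
  have hevid : ∀ n : ℕ, ENNReal.ofReal (Real.exp (-(n * a)) * ℓ₀ n) * prior U ≤
      M.evidence prior n fun i => D i ω := fun n => by
    calc ENNReal.ofReal (Real.exp (-(n * a)) * ℓ₀ n) * prior U
        = ∫⁻ _ in U, ENNReal.ofReal (Real.exp (-(n * a)) * ℓ₀ n) ∂prior :=
          (setLIntegral_const _ _).symm
      _ ≤ ∫⁻ q in U, ENNReal.ofReal (M.likelihood q.1 (mixtureLaw q.2) n fun i => D i ω) ∂prior :=
          setLIntegral_mono' hUm fun q hq => ENNReal.ofReal_le_ofReal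
            (hlower _ hω (π q) (fun s => hU q hq s.1 s.2) n)
      _ ≤ _ := setLIntegral_le_lintegral _ _
  refine ⟨fun n => ⟨?_, ?_⟩, ?_⟩
  · refine (lt_of_lt_of_le ?_ (hevid n)).ne'
    exact ENNReal.mul_pos (ENNReal.ofReal_pos.2 (mul_pos (Real.exp_pos _) (hℓ₀pos n))).ne' hU0.ne'
  · refine ne_top_of_le_ne_top (b := ∫⁻ _, 1 ∂prior) (by simp) (lintegral_mono fun q => ?_)
    rw [hlik, ENNReal.ofReal_le_one]
    exact Finset.prod_le_one (fun i _ => Finset.prod_nonneg fun t _ => (hπ01 q _).1) fun i _ =>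
      Finset.prod_le_one (fun t _ => (hπ01 q _).1) fun t _ => (hπ01 q _).2
  · have hbound : ∀ᶠ n : ℕ in Filter.atTop, M.posterior prior n (fun i => D i ω)
        {q | δ < ‖M.ccpVec θ₀ F₀ - M.ccpVec q.1 (mixtureLaw q.2)‖} ≤
        ENNReal.ofReal (Real.exp (-(2 * (n * a)))) * (prior U)⁻¹ := by
      filter_upwards [hupper _ hω hN'] with n hn
      refine ENNReal.div_le_of_le_mul ?_
      calc ∫⁻ q in {q | δ < ‖M.ccpVec θ₀ F₀ - M.ccpVec q.1 (mixtureLaw q.2)‖},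
            ENNReal.ofReal (M.likelihood q.1 (mixtureLaw q.2) n fun i => D i ω) ∂prior
          ≤ ∫⁻ _ in {q | δ < ‖M.ccpVec θ₀ F₀ - M.ccpVec q.1 (mixtureLaw q.2)‖},
            ENNReal.ofReal (Real.exp (-(3 * (n * a))) * ℓ₀ n) ∂prior := by
            -- Only the dominating constant has to be measurable, not the likelihood as a function
            -- of the parameters nor the far set.
            refine setLIntegral_mono measurable_const fun q hq => ENNReal.ofReal_le_ofReal ?_
            refine hn (π q) (hπ01 q)
              (fun x => M.sum_ccp q.1 (mixtureLaw_absolutelyContinuous q.2) x) ?_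
            have hq : δ < ‖M.ccpVec θ₀ F₀ - M.ccpVec q.1 (mixtureLaw q.2)‖ := hq
            have h2 := pow_lt_pow_left₀ hq hδ.le two_ne_zero
            rw [EuclideanSpace.real_norm_sq_eq] at h2
            exact h2
        _ ≤ ENNReal.ofReal (Real.exp (-(3 * (n * a))) * ℓ₀ n) := by
            rw [setLIntegral_const]
            exact mul_le_of_le_one_right' prob_le_one
        _ = (ENNReal.ofReal (Real.exp (-(2 * (n * a)))) * (prior U)⁻¹) *
            (ENNReal.ofReal (Real.exp (-(n * a)) * ℓ₀ n) * prior U) := by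
            rw [mul_mul_mul_comm, ENNReal.inv_mul_cancel hU0.ne' (measure_ne_top _ _), mul_one,
              ← ENNReal.ofReal_mul (Real.exp_pos _).le, ← mul_assoc (Real.exp _), ← Real.exp_add]
            congr 3
            ring
        _ ≤ _ := mul_le_mul_right (hevid n) _
    refine tendsto_of_tendsto_of_tendsto_of_le_of_le' tendsto_const_nhds ?_
      (Filter.Eventually.of_forall fun _ => zero_le) hbound
    have hlim : Filter.Tendsto (fun n : ℕ => Real.exp (-(2 * (n * a)))) Filter.atTop (nhds 0) :=
      Real.tendsto_exp_neg_atTop_nhds_zero.comp (Filter.Tendsto.const_mul_atTop two_pos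
        (tendsto_natCast_atTop_atTop.atTop_mul_const ha))
    have h := ENNReal.Tendsto.mul_const (b := (prior U)⁻¹) (ENNReal.tendsto_ofReal hlim)
      (Or.inr (ENNReal.inv_ne_top.2 hU0.ne'))
    rwa [ENNReal.ofReal_zero, zero_mul] at h
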